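/- Let $n\ge 1$, let $a\ge 1$ be an odd integer, and let $\lambda\in\mathbb C$ with $\lambda^4\notin\{0,1\}$. Let $S_{a,\lambda}$ be the compact Riemann surface obtained by normalizing the projective closure of the plane curve $$y^{2^n}=x^a(x^2-1)^a(x^2-\lambda^2)(x^2-\lambda^{-2}).$$ The surface $S_{a,\lambda}$ consists of the affine points $(x,y)$ of this curve together with exactly one point $\infty$ at infinity. Put $\omega=\exp(2\pi i/2^{n+1})$, and suppose that $c$ is a natural number with $c\cdot 2^{n-1}=2a+2$. Consider the self-maps of $S_{a,\lambda}$ $$\tau_1(x,y)=(-x,\ \omega y),\qquad \tau_2(x,y)=\Bigl(\frac1x,\ \frac{\omega y}{x^{c}}\Bigr),$$ where $\tau_1(\infty)=\infty$, and $\tau_2$ interchanges $(0,0)$ and $\infty$. Then $\tau_1$ and $\tau_2$ are automorphisms (biholomorphic self-maps) of $S_{a,\lambda}$, each of order $2^{n+1}$. Moreover, let $\langle\tau_1,\tau_2\rangle$ be the subgroup of $\mathrm{Aut}(S_{a,\lambda})$ that they generate. 1. If $c$ is even, then $\langle\tau_1,\tau_2\rangle$ is abelian and isomorphic to $\mathbb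 Z/2^{n+1}\mathbb Z\times\mathbb Z/2\mathbb Z$. 2. If $c$ is odd, then $\tau_2\tau_1=\tau_1^{2^n+1}\tau_2$, and $\langle\tau_1,\tau_2\rangle$ is isomorphic to $\mathbb Z/2^{n+1}\mathbb Z\rtimes_h\mathbb Z/2\mathbb Z$, where the generator of $\mathbb Z/2\mathbb Z$ acts on $\mathbb Z/2^{n+1}\mathbb Z$ by multiplication by $2^n+1$. -/

import Mathlib

noncomputable section

open Set Filter Topology
open scoped Manifold ContDiff

namespace TwoPowerCurve

/-- The polynomial `x^a (x² - 1)^a (x² - λ²) (x² - λ⁻²)`. -/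
def rhs (a : ℕ) (lam x : ℂ) : ℂ :=
  x ^ a * (x ^ 2 - 1) ^ a * (x ^ 2 - lam ^ 2) * (x ^ 2 - (lam ^ 2)⁻¹)

/-- `f_{a,λ}(x,y) = y^(2^n) - x^a (x² - 1)^a (x² - λ²) (x² - λ⁻²)`. -/
def poly (n a : ℕ) (lam x y : ℂ) : ℂ := y ^ 2 ^ n - rhs a lam x

/-- The affine plane curve `f_{a,λ}(x,y) = 0`. -/
def affineCurve (n a : ℕ) (lam : ℂ) : Set (ℂ × ℂ) := {p | poly n a lam p.1 p.2 = 0}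

/-- The points of the normalization of the projective closure of the affine curve. For odd `a` each
singular point of the closure has a single branch and there is a single point at infinity, so that
as a topological space the normalization is the one-point compactification of the affine curve. -/
abbrev Pts (n a : ℕ) (lam : ℂ) : Type := OnePoint (affineCurve n a lam)

/-- The coordinate function `x` (with the junk value `0` at the point at infinity). -/
def xCoord {n a : ℕ} {lam : ℂ} (P : Pts n a lam) : ℂ := P.elim 0 (fun p => p.1.1)

/-- The coordinate function `y` (with the junk value `0` at the point at infinity). -/
def yCoord {n a : ℕ} {lam : ℂ} (P : Pts n a lam) : ℂ := P.elim 0 (fun p => p.1.2)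

/-- The holomorphic charts of the normalization: local homeomorphisms to `ℂ` in which both `x` and
`y` are holomorphic away from the point at infinity. Examples are the Puiseux charts, with inverse
`s ↦ (p + s^(2^n), s^m q(p + s^(2^n)))` at a zero `p` of order `m` of the right-hand side, and
`s ↦ (s^(-2^n), s^(-3a-4) q(s^(2^n)))` at infinity, `q` being holomorphic and nowhere zero. -/
def IsChart {n a : ℕ} {lam : ℂ} (e : OpenPartialHomeomorph (Pts n a lam) ℂ) : Prop :=
  DifferentiableOn ℂ (fun s => xCoord (e.symm s)) {s | s ∈ e.target ∧ e.symm s ≠ OnePoint.infty} ∧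
  DifferentiableOn ℂ (fun s => yCoord (e.symm s)) {s | s ∈ e.target ∧ e.symm s ≠ OnePoint.infty}

theorem mem_affineCurve {n a : ℕ} {lam : ℂ} {p : ℂ × ℂ} :
    p ∈ affineCurve n a lam ↔ p.2 ^ 2 ^ n = rhs a lam p.1 := by
  simp [affineCurve, poly, sub_eq_zero]

theorem differentiable_rhs (a : ℕ) (lam : ℂ) : Differentiable ℂ (rhs a lam) := by
  unfold rhs; fun_prop

theorem isClosed_affineCurve (n a : ℕ) (lam : ℂ) : IsClosed (affineCurve n a lam) := by
  have : Continuous (fun p : ℂ × ℂ => poly n a lam p.1 p.2) := by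
    have := (differentiable_rhs a lam).continuous
    unfold poly; fun_prop
  exact isClosed_eq this continuous_const

instance (n a : ℕ) (lam : ℂ) : LocallyCompactSpace (affineCurve n a lam) :=
  (isClosed_affineCurve n a lam).locallyCompactSpace

/-- A continuous injection of a closed disc with open image of the open disc is the inverse
of a chart. -/
theorem exists_openPartialHomeomorph {M : Type*} [TopologicalSpace M] [T2Space M] (φ : ℂ → M)
    (r : ℝ) (hcont : ContinuousOn φ (Metric.closedBall 0 r))
    (hinj : InjOn φ (Metric.closedBall 0 r)) (hopen : IsOpen (φ '' Metric.ball 0 r)) :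
    ∃ e : OpenPartialHomeomorph M ℂ, e.source = φ '' Metric.ball 0 r ∧
      e.target = Metric.ball 0 r ∧ ∀ s, e.symm s = φ s := by
  have hsub := Metric.ball_subset_closedBall (x := (0 : ℂ)) (ε := r)
  have hinj' := hinj.mono hsub
  let E : PartialEquiv ℂ M := hinj'.toPartialEquiv φ (Metric.ball 0 r)
  have hEs : E.source = Metric.ball 0 r := rfl
  have hEt : E.target = φ '' Metric.ball 0 r := rfl
  have hc : ContinuousOn E.symm E.target := by
    rw [continuousOn_iff_isClosed]
    intro t ht
    refine ⟨φ '' (t ∩ Metric.closedBall 0 r), ?_, ?_⟩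
    · exact (((isCompact_closedBall 0 r).inter_left ht).image_of_continuousOn
        (hcont.mono inter_subset_right)).isClosed
    · ext P
      constructor
      · rintro ⟨h1, s, hs, rfl⟩
        have : E.symm (φ s) = s := E.left_inv hs
        simp only [mem_preimage] at h1
        rw [this] at h1
        exact ⟨⟨s, ⟨h1, hsub hs⟩, rfl⟩, ⟨s, hs, rfl⟩⟩
      · rintro ⟨⟨s', ⟨h1, h2⟩, h3⟩, s, hs, rfl⟩
        have : E.symm (φ s) = s := E.left_inv hs
        have h4 : s' = s := hinj h2 (hsub hs) h3
        subst h4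
        refine ⟨?_, ⟨_, hs, rfl⟩⟩
        simp only [mem_preimage]
        rwa [this]
  let e : OpenPartialHomeomorph ℂ M :=
    { toPartialEquiv := E
      open_source := Metric.isOpen_ball
      open_target := hopen
      continuousOn_toFun := hcont.mono hsub
      continuousOn_invFun := hc }
  exact ⟨e.symm, rfl, rfl, fun s => rfl⟩

/-- Local holomorphic roots. -/
theorem exists_root {N : ℕ} (hN : N ≠ 0) {r : ℂ → ℂ} (hr : Differentiable ℂ r) {p w : ℂ}
    (hw : w ^ N = r p) (hp : r p ≠ 0) :
    ∃ ρ > 0, ∃ q : ℂ → ℂ, DifferentiableOn ℂ q (Metric.ball p ρ) ∧ q p = w ∧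
      ∀ x ∈ Metric.ball p ρ, q x ^ N = r x ∧ q x ≠ 0 := by
  have h1 : ∀ᶠ x in 𝓝 p, r x / r p ∈ Complex.slitPlane := by
    have : ContinuousAt (fun x => r x / r p) p := by
      have := hr.continuous
      fun_prop
    apply this.eventually_mem
    apply Complex.isOpen_slitPlane.mem_nhds
    simp [div_self hp]
  obtain ⟨ρ, hρ, hb⟩ := Metric.eventually_nhds_iff_ball.1 h1
  have key : ∀ x ∈ Metric.ball p ρ, (w * (r x / r p) ^ ((N : ℂ)⁻¹)) ^ N = r x := by
    intro x hx
    rw [mul_pow, Complex.cpow_nat_inv_pow _ hN, hw]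
    field_simp
  refine ⟨ρ, hρ, fun x => w * (r x / r p) ^ ((N : ℂ)⁻¹), ?_, ?_, ?_⟩
  · intro x hx
    refine DifferentiableWithinAt.const_mul ?_ _
    refine DifferentiableAt.differentiableWithinAt ?_
    exact ((hr x).div_const _).cpow_const (hb x hx)
  · simp [div_self hp]
  · intro x hx
    refine ⟨key x hx, fun h => ?_⟩
    have := key x hx
    simp only at h
    rw [h, zero_pow hN] at this
    have h2 := hb x hx
    rw [← this] at h2
    simp at h2

/-- The point of the surface with coordinates `(x, y)`. -/
def mkPt {n a : ℕ} {lam : ℂ} (x y : ℂ) : Pts n a lam :=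
  open Classical in if h : (x, y) ∈ affineCurve n a lam then ((⟨(x, y), h⟩ : affineCurve n a lam) : Pts n a lam)
    else OnePoint.infty

section
variable {n a : ℕ} {lam : ℂ}

theorem mkPt_of_mem {x y : ℂ} (h : (x, y) ∈ affineCurve n a lam) :
    (mkPt x y : Pts n a lam) = ((⟨(x, y), h⟩ : affineCurve n a lam) : Pts n a lam) := by
  simp [mkPt, h]

theorem xCoord_coe (p : affineCurve n a lam) : xCoord (p : Pts n a lam) = p.1.1 := rfl
theorem yCoord_coe (p : affineCurve n a lam) : yCoord (p : Pts n a lam) = p.1.2 := rfl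

theorem xCoord_mkPt {x y : ℂ} (h : (x, y) ∈ affineCurve n a lam) :
    xCoord (mkPt x y : Pts n a lam) = x := by rw [mkPt_of_mem h]; rfl

theorem yCoord_mkPt {x y : ℂ} (h : (x, y) ∈ affineCurve n a lam) :
    yCoord (mkPt x y : Pts n a lam) = y := by rw [mkPt_of_mem h]; rfl

theorem mkPt_ne_infty {x y : ℂ} (h : (x, y) ∈ affineCurve n a lam) :
    (mkPt x y : Pts n a lam) ≠ OnePoint.infty := by
  rw [mkPt_of_mem h]; exact OnePoint.coe_ne_infty _

theorem mkPt_inj {x y x' y' : ℂ} (h : (x, y) ∈ affineCurve n a lam)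
    (h' : (x', y') ∈ affineCurve n a lam)
    (e : (mkPt x y : Pts n a lam) = mkPt x' y') : x = x' ∧ y = y' := by
  have h1 := congrArg xCoord e
  have h2 := congrArg yCoord e
  rw [xCoord_mkPt h, xCoord_mkPt h'] at h1
  rw [yCoord_mkPt h, yCoord_mkPt h'] at h2
  exact ⟨h1, h2⟩

theorem continuousOn_mkPt {X Y : ℂ → ℂ} {D : Set ℂ} (hX : ContinuousOn X D)
    (hY : ContinuousOn Y D) (h : ∀ s ∈ D, (X s, Y s) ∈ affineCurve n a lam) :
    ContinuousOn (fun s => (mkPt (X s) (Y s) : Pts n a lam)) D := by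
  rw [continuousOn_iff_continuous_domRestrict] at *
  have : D.domRestrict (fun s => (mkPt (X s) (Y s) : Pts n a lam)) =
      fun s : D => ((⟨(X s, Y s), h s s.2⟩ : affineCurve n a lam) : Pts n a lam) := by
    funext s
    exact mkPt_of_mem (h s s.2)
  rw [this]
  exact OnePoint.continuous_coe.comp ((hX.prodMk hY).subtype_mk _)

theorem isChart_of {e : OpenPartialHomeomorph (Pts n a lam) ℂ} {X Y : ℂ → ℂ}
    (h : ∀ s ∈ e.target, e.symm s ≠ OnePoint.infty →
      e.symm s = mkPt (X s) (Y s) ∧ (X s, Y s) ∈ affineCurve n a lam ∧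
        DifferentiableAt ℂ X s ∧ DifferentiableAt ℂ Y s) : IsChart e := by
  refine ⟨DifferentiableOn.congr (f := X) ?_ ?_, DifferentiableOn.congr (f := Y) ?_ ?_⟩
  · exact fun s hs => (h s hs.1 hs.2).2.2.1.differentiableWithinAt
  · intro s hs
    obtain ⟨h1, h2, -⟩ := h s hs.1 hs.2
    rw [h1, xCoord_mkPt h2]
  · exact fun s hs => (h s hs.1 hs.2).2.2.2.differentiableWithinAt
  · intro s hs
    obtain ⟨h1, h2, -⟩ := h s hs.1 hs.2
    rw [h1, yCoord_mkPt h2]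

theorem finite_roots {N : ℕ} (hN : N ≠ 0) (c : ℂ) : {z : ℂ | z ^ N = c}.Finite := by
  have hp : (Polynomial.X ^ N - Polynomial.C c : Polynomial ℂ) ≠ 0 :=
    Polynomial.X_pow_sub_C_ne_zero (Nat.pos_of_ne_zero hN) c
  refine (Polynomial.finite_setOfPred_isRoot hp).subset ?_
  intro z hz
  simpa [Polynomial.IsRoot, sub_eq_zero] using hz

/-- Chart at an unramified point: `x` is a local coordinate. -/
theorem exists_chart_unramified (p : affineCurve n a lam) (hp : rhs a lam p.1.1 ≠ 0) :
    ∃ e : OpenPartialHomeomorph (Pts n a lam) ℂ, (p : Pts n a lam) ∈ e.source ∧ IsChart e := by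
  obtain ⟨⟨x₀, y₀⟩, hxy⟩ := p
  have hN : 2 ^ n ≠ 0 := by positivity
  simp only at hp
  have hxy' := mem_affineCurve.1 hxy
  simp only at hxy'
  obtain ⟨ρ, hρ, q, hq, hq0, hqN⟩ := exists_root hN (differentiable_rhs a lam) hxy' hp
  have hmem : ∀ s ∈ Metric.ball (0 : ℂ) ρ, x₀ + s ∈ Metric.ball x₀ ρ := by
    intro s hs; simpa using hs
  have hcurve : ∀ s ∈ Metric.ball (0 : ℂ) ρ, (x₀ + s, q (x₀ + s)) ∈ affineCurve n a lam :=
    fun s hs => mem_affineCurve.2 (hqN _ (hmem s hs)).1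
  have hYd : ∀ s ∈ Metric.ball (0 : ℂ) ρ, DifferentiableAt ℂ (fun s => q (x₀ + s)) s := by
    intro s hs
    have h1 : DifferentiableAt ℂ q (x₀ + s) :=
      hq.differentiableAt (Metric.isOpen_ball.mem_nhds (hmem s hs))
    exact DifferentiableAt.comp s h1 (by fun_prop)
  have hsub : Metric.closedBall (0 : ℂ) (ρ / 2) ⊆ Metric.ball 0 ρ :=
    Metric.closedBall_subset_ball (by linarith)
  have hsub' : Metric.ball (0 : ℂ) (ρ / 2) ⊆ Metric.ball 0 ρ :=
    Metric.ball_subset_ball (by linarith)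
  set φ : ℂ → Pts n a lam := fun s => mkPt (x₀ + s) (q (x₀ + s)) with hφ
  obtain ⟨e, he1, he2, he3⟩ := exists_openPartialHomeomorph φ (ρ / 2)
    (continuousOn_mkPt (by fun_prop)
      (fun s hs => (hYd s (hsub hs)).continuousAt.continuousWithinAt)
      (fun s hs => hcurve s (hsub hs)))
    (by
      intro s hs t ht hst
      have := (mkPt_inj (hcurve s (hsub hs)) (hcurve t (hsub ht)) hst).1
      simpa using this)
    (by
      have hF : ({z : ℂ | z ^ 2 ^ n = 1} \ {1}).Finite := (finite_roots hN 1).sdiff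
      have hO : IsOpen {P : affineCurve n a lam | P.1.1 ∈ Metric.ball x₀ (ρ / 2) ∧
          P.1.2 / q P.1.1 ∈ ({z : ℂ | z ^ 2 ^ n = 1} \ {1})ᶜ} := by
        rw [isOpen_iff_mem_nhds]
        rintro ⟨⟨x, y⟩, hP⟩ ⟨h1, h2⟩
        have hxb : x ∈ Metric.ball x₀ ρ := Metric.ball_subset_ball (by linarith) h1
        have c1 : ContinuousAt (fun P : affineCurve n a lam => P.1.1) ⟨(x, y), hP⟩ := by fun_prop
        have c2 : ContinuousAt (fun P : affineCurve n a lam => P.1.2 / q P.1.1) ⟨(x, y), hP⟩ := by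
          refine ContinuousAt.div (by fun_prop) ?_ (hqN x hxb).2
          refine ContinuousAt.comp (g := q) ?_ c1
          exact (hq.differentiableAt (Metric.isOpen_ball.mem_nhds hxb)).continuousAt
        exact (c1.eventually_mem (Metric.isOpen_ball.mem_nhds h1)).and
          (c2.eventually_mem (hF.isClosed.isOpen_compl.mem_nhds h2))
      convert OnePoint.isOpen_image_coe.2 hO using 1
      ext P
      constructor
      · rintro ⟨s, hs, rfl⟩
        refine ⟨⟨(x₀ + s, q (x₀ + s)), hcurve s (hsub' hs)⟩, ⟨?_, ?_⟩, ?_⟩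
        · simpa using hs
        · simp [div_self (hqN _ (hmem s (hsub' hs))).2]
        · exact (mkPt_of_mem _).symm
      · rintro ⟨⟨⟨x, y⟩, hP⟩, ⟨h1, h2⟩, rfl⟩
        have hxb : x ∈ Metric.ball x₀ ρ := Metric.ball_subset_ball (by linarith) h1
        have h3 : y = q x := by
          have h4 : (y / q x) ^ 2 ^ n = 1 := by
            rw [div_pow, mem_affineCurve.1 hP, (hqN x hxb).1]
            refine div_self ?_
            rw [← (hqN x hxb).1]
            exact pow_ne_zero _ (hqN x hxb).2
          have h5 : y / q x = 1 := by
            by_contra h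
            exact h2 ⟨h4, h⟩
          rwa [div_eq_one_iff_eq (hqN x hxb).2] at h5
        refine ⟨x - x₀, ?_, ?_⟩
        · simpa [dist_eq_norm] using h1
        · subst h3
          simp only [hφ, add_sub_cancel]
          exact mkPt_of_mem hP)
  refine ⟨e, ?_, isChart_of (X := fun s => x₀ + s) (Y := fun s => q (x₀ + s)) ?_⟩
  · rw [he1]
    refine ⟨0, by simpa using hρ, ?_⟩
    simp only [hφ, add_zero, hq0]
    exact mkPt_of_mem hxy
  · intro s hs _
    rw [he2] at hs
    exact ⟨he3 s, hcurve s (hsub' hs), by fun_prop, hYd s (hsub' hs)⟩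

theorem exists_pow_pow_eq {N m : ℕ} (hN : 1 < N) (hm : m.Coprime N) {z w : ℂ} (hz : z ≠ 0)
    (h : w ^ N = z ^ m) : ∃ s : ℂ, s ^ N = z ∧ s ^ m = w := by
  obtain ⟨t, ht⟩ := IsAlgClosed.exists_pow_nat_eq z (by omega : 0 < N)
  have ht0 : t ≠ 0 := by
    rintro rfl
    rw [zero_pow (by omega)] at ht
    exact hz ht.symm
  obtain ⟨u, -, hu⟩ := Nat.exists_mul_mod_eq_one_of_coprime hm hN
  have h1 : (w / t ^ m) ^ N = 1 := by
    rw [div_pow, h, ← ht, ← pow_mul, ← pow_mul, mul_comm m N]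
    exact div_self (pow_ne_zero _ ht0)
  refine ⟨t * (w / t ^ m) ^ u, ?_, ?_⟩
  · rw [mul_pow, ht, ← pow_mul, mul_comm u N, pow_mul, h1, one_pow, mul_one]
  · rw [mul_pow, ← pow_mul, mul_comm u m, pow_eq_pow_mod _ h1, hu, pow_one]
    field_simp

theorem eq_of_pow_eq_pow {N m : ℕ} (hN : N ≠ 0) (hm : m.Coprime N) {s t : ℂ}
    (h1 : s ^ N = t ^ N) (h2 : s ^ m = t ^ m) : s = t := by
  by_cases ht : t = 0
  · subst ht
    rw [zero_pow hN] at h1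
    exact pow_eq_zero_iff hN |>.1 h1
  · have e1 : (s / t) ^ N = 1 := by rw [div_pow, h1, div_self (pow_ne_zero _ ht)]
    have e2 : (s / t) ^ m = 1 := by rw [div_pow, h2, div_self (pow_ne_zero _ ht)]
    have := pow_gcd_eq_one.2 ⟨e2, e1⟩
    rw [hm, pow_one, div_eq_one_iff_eq ht] at this
    exact this

theorem exists_radius {ρ : ℝ} (hρ : 0 < ρ) {N : ℕ} (hN : N ≠ 0) :
    ∃ R : ℝ, 0 < R ∧ ∀ s ∈ Metric.closedBall (0 : ℂ) R, ‖s ^ N‖ < ρ := by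
  refine ⟨min 1 (ρ / 2), by positivity, fun s hs => ?_⟩
  have h1 : ‖s‖ ≤ min 1 (ρ / 2) := by simpa using hs
  have h2 : ‖s‖ ^ N ≤ ‖s‖ :=
    pow_le_of_le_one (norm_nonneg _) (h1.trans (min_le_left _ _)) hN
  rw [norm_pow]
  have := h1.trans (min_le_right _ _)
  linarith

/-- The Puiseux chart at a ramification point with finite coordinates. -/
theorem exists_chart_ramified (hn : 1 ≤ n) {p : ℂ} {m : ℕ} (hm : Odd m) {r : ℂ → ℂ}
    (hr : Differentiable ℂ r) (hrp : r p ≠ 0) (hg : ∀ x, rhs a lam x = (x - p) ^ m * r x)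
    (P : affineCurve n a lam) (hP : P.1.1 = p) :
    ∃ e : OpenPartialHomeomorph (Pts n a lam) ℂ, (P : Pts n a lam) ∈ e.source ∧ IsChart e := by
  have hN : 2 ^ n ≠ 0 := by positivity
  have hN1 : 1 < 2 ^ n := Nat.one_lt_two_pow (by omega)
  have hcop : m.Coprime (2 ^ n) := (Nat.coprime_two_right.2 hm).pow_right n
  have hm0 : m ≠ 0 := by rintro rfl; simp at hm
  obtain ⟨w, hw⟩ := IsAlgClosed.exists_pow_nat_eq (r p) (Nat.pos_of_ne_zero hN)
  obtain ⟨ρ, hρ, q, hq, -, hqN⟩ := exists_root hN hr hw hrp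
  obtain ⟨R, hR, hRρ⟩ := exists_radius hρ hN
  have hmem : ∀ s ∈ Metric.closedBall (0 : ℂ) R, p + s ^ 2 ^ n ∈ Metric.ball p ρ := by
    intro s hs; simpa using hRρ s hs
  have hcurve : ∀ s ∈ Metric.closedBall (0 : ℂ) R,
      (p + s ^ 2 ^ n, s ^ m * q (p + s ^ 2 ^ n)) ∈ affineCurve n a lam := by
    intro s hs
    rw [mem_affineCurve]
    simp only
    rw [mul_pow, (hqN _ (hmem s hs)).1, hg, add_sub_cancel_left, ← pow_mul, ← pow_mul,
      mul_comm m]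
  have hYd : ∀ s ∈ Metric.closedBall (0 : ℂ) R,
      DifferentiableAt ℂ (fun s => s ^ m * q (p + s ^ 2 ^ n)) s := by
    intro s hs
    have h1 : DifferentiableAt ℂ q (p + s ^ 2 ^ n) :=
      hq.differentiableAt (Metric.isOpen_ball.mem_nhds (hmem s hs))
    refine DifferentiableAt.mul (by fun_prop) ?_
    exact DifferentiableAt.comp (g := q) s h1 (by fun_prop)
  have hsub' : Metric.ball (0 : ℂ) R ⊆ Metric.closedBall 0 R := Metric.ball_subset_closedBall
  set φ : ℂ → Pts n a lam := fun s => mkPt (p + s ^ 2 ^ n) (s ^ m * q (p + s ^ 2 ^ n)) with hφ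
  obtain ⟨e, he1, he2, he3⟩ := exists_openPartialHomeomorph φ R
    (continuousOn_mkPt (by fun_prop)
      (fun s hs => (hYd s hs).continuousAt.continuousWithinAt)
      (fun s hs => hcurve s hs))
    (by
      intro s hs t ht hst
      obtain ⟨h1, h2⟩ := mkPt_inj (hcurve s hs) (hcurve t ht) hst
      rw [h1] at h2
      exact eq_of_pow_eq_pow hN hcop (by simpa using h1)
        (mul_right_cancel₀ (hqN _ (hmem t ht)).2 h2))
    (by
      have hO : IsOpen {P : affineCurve n a lam | ‖P.1.1 - p‖ < R ^ 2 ^ n} :=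
        isOpen_lt (by fun_prop) continuous_const
      convert OnePoint.isOpen_image_coe.2 hO using 1
      ext P
      constructor
      · rintro ⟨s, hs, rfl⟩
        refine ⟨⟨_, hcurve s (hsub' hs)⟩, ?_, (mkPt_of_mem _).symm⟩
        simp only [mem_ofPred_eq, add_sub_cancel_left, norm_pow]
        have : ‖s‖ < R := by simpa using hs
        gcongr
      · rintro ⟨⟨⟨x, y⟩, hP⟩, h1, rfl⟩
        simp only [mem_ofPred_eq] at h1
        have hP' := mem_affineCurve.1 hP
        simp only [hg] at hP'
        have hfin : ∀ s : ℂ, s ^ 2 ^ n = x - p → s ^ m * q x = y →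
            ((⟨(x, y), hP⟩ : affineCurve n a lam) : Pts n a lam) ∈ φ '' Metric.ball 0 R := by
          intro s hs1 hs2
          refine ⟨s, ?_, ?_⟩
          · rw [← hs1, norm_pow] at h1
            simpa using lt_of_pow_lt_pow_left₀ _ hR.le h1
          · simp only [hφ, hs1, add_sub_cancel, hs2]
            exact mkPt_of_mem hP
        by_cases hx : x = p
        · subst hx
          refine hfin 0 (by simp) ?_
          rw [sub_self, zero_pow hm0, zero_mul] at hP'
          rw [zero_pow hm0, zero_mul, (pow_eq_zero_iff hN).1 hP']
        · have hxb : x ∈ Metric.ball p ρ := by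
            have h2 := hRρ (R : ℂ) (by simp [abs_of_pos hR])
            rw [norm_pow, Complex.norm_real, Real.norm_of_nonneg hR.le] at h2
            rw [mem_ball_iff_norm]
            exact h1.trans h2
          obtain ⟨s, hs1, hs2⟩ := exists_pow_pow_eq hN1 hcop (z := x - p) (w := y / q x)
            (sub_ne_zero.2 hx) (by
              rw [div_pow, hP', (hqN x hxb).1, mul_div_cancel_right₀]
              rw [← (hqN x hxb).1]
              exact pow_ne_zero _ (hqN x hxb).2)
          refine hfin s hs1 ?_
          rw [hs2, div_mul_cancel₀ _ (hqN x hxb).2])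
  refine ⟨e, ?_, isChart_of (X := fun s => p + s ^ 2 ^ n)
    (Y := fun s => s ^ m * q (p + s ^ 2 ^ n)) ?_⟩
  · rw [he1]
    refine ⟨0, by simpa using hR, ?_⟩
    have h0 := hcurve 0 (by simpa using hR.le)
    simp only [hφ]
    rw [mkPt_of_mem h0]
    congr 1
    apply Subtype.ext
    have hP' := mem_affineCurve.1 P.2
    rw [hg, hP, sub_self, zero_pow hm0, zero_mul, pow_eq_zero_iff hN] at hP'
    ext
    · simp [hP]
    · simp [hP', hm0]
  · intro s hs _
    rw [he2] at hs
    exact ⟨he3 s, hcurve s (hsub' hs), by fun_prop, hYd s (hsub' hs)⟩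

theorem isCompact_norm_le (c : ℝ) :
    IsCompact {P : affineCurve n a lam | ‖P.1.1‖ ≤ c} := by
  rw [Subtype.isCompact_iff]
  obtain ⟨B, hB⟩ := (isCompact_closedBall (0 : ℂ) c).exists_bound_of_continuousOn
    (differentiable_rhs a lam).continuous.continuousOn
  refine ((isCompact_closedBall (0 : ℂ) c).prod
    (isCompact_closedBall (0 : ℂ) (max 1 B))).of_isClosed_subset ?_ ?_
  · have : IsClosed {P : affineCurve n a lam | ‖P.1.1‖ ≤ c} :=
      isClosed_le (by fun_prop) continuous_const
    exact (isClosed_affineCurve n a lam).isClosedEmbedding_subtypeVal.isClosedMap _ this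
  · rintro _ ⟨⟨⟨x, y⟩, hP⟩, h, rfl⟩
    simp only [mem_ofPred_eq] at h
    have hx : x ∈ Metric.closedBall (0 : ℂ) c := by simpa using h
    refine ⟨hx, ?_⟩
    have h1 := hB x hx
    rw [← mem_affineCurve.1 hP, norm_pow] at h1
    simp only [mem_closedBall_zero_iff]
    by_contra! h2
    have h3 : (1 : ℝ) ≤ ‖y‖ := (le_max_left _ _).trans h2.le
    have h4 : ‖y‖ ≤ ‖y‖ ^ 2 ^ n := le_self_pow₀ h3 (by positivity)
    exact absurd ((h4.trans h1).trans (le_max_right _ _)) (not_le.2 h2)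

/-- The reciprocal polynomial of `rhs`. -/
def rhsInv (a : ℕ) (lam u : ℂ) : ℂ :=
  (1 - u ^ 2) ^ a * (1 - lam ^ 2 * u ^ 2) * (1 - (lam ^ 2)⁻¹ * u ^ 2)

theorem rhs_inv {u : ℂ} (hu : u ≠ 0) :
    rhs a lam u⁻¹ = (u ^ (3 * a + 4))⁻¹ * rhsInv a lam u := by
  have e1 : u⁻¹ ^ 2 - 1 = (1 - u ^ 2) * (u⁻¹) ^ 2 := by field_simp
  have e2 : ∀ b : ℂ, u⁻¹ ^ 2 - b = (1 - b * u ^ 2) * (u⁻¹) ^ 2 := by intro b; field_simp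
  rw [rhs, rhsInv, e1, e2 (lam ^ 2), e2 ((lam ^ 2)⁻¹), mul_pow, ← inv_pow, ← pow_mul]
  ring

/-- The Puiseux chart at infinity. -/
theorem exists_chart_infty (hn : 1 ≤ n) (ha : Odd a) :
    ∃ e : OpenPartialHomeomorph (Pts n a lam) ℂ, OnePoint.infty ∈ e.source ∧ IsChart e := by
  classical
  have hN : 2 ^ n ≠ 0 := by positivity
  have hN1 : 1 < 2 ^ n := Nat.one_lt_two_pow (by omega)
  set M := 3 * a + 4 with hM
  have hcop : M.Coprime (2 ^ n) := by
    refine (Nat.coprime_two_right.2 ?_).pow_right n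
    obtain ⟨b, rfl⟩ := ha
    exact ⟨3 * b + 3, by omega⟩
  have hM0 : M ≠ 0 := by omega
  have hr : Differentiable ℂ (rhsInv a lam) := by unfold rhsInv; fun_prop
  have hr0 : rhsInv a lam 0 = 1 := by simp [rhsInv]
  obtain ⟨ρ, hρ, q, hq, -, hqN⟩ := exists_root hN hr (p := 0) (w := 1) (by simp [hr0])
    (by simp [hr0])
  obtain ⟨R, hR, hRρ⟩ := exists_radius hρ hN
  have hmem : ∀ s ∈ Metric.closedBall (0 : ℂ) R, s ^ 2 ^ n ∈ Metric.ball 0 ρ := by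
    intro s hs; simpa using hRρ s hs
  have hcurve : ∀ s ∈ Metric.closedBall (0 : ℂ) R, s ≠ 0 →
      ((s ^ 2 ^ n)⁻¹, (s ^ M)⁻¹ * q (s ^ 2 ^ n)) ∈ affineCurve n a lam := by
    intro s hs h0
    rw [mem_affineCurve]
    simp only
    rw [mul_pow, (hqN _ (hmem s hs)).1, rhs_inv (pow_ne_zero _ h0), ← pow_mul, inv_pow, ← pow_mul,
      mul_comm M]
  have hXd : ∀ s : ℂ, s ≠ 0 → DifferentiableAt ℂ (fun s : ℂ => (s ^ 2 ^ n)⁻¹) s := by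
    intro s h0
    exact DifferentiableAt.inv (by fun_prop) (pow_ne_zero _ h0)
  have hYd : ∀ s ∈ Metric.closedBall (0 : ℂ) R, s ≠ 0 →
      DifferentiableAt ℂ (fun s => (s ^ M)⁻¹ * q (s ^ 2 ^ n)) s := by
    intro s hs h0
    have h1 : DifferentiableAt ℂ q (s ^ 2 ^ n) :=
      hq.differentiableAt (Metric.isOpen_ball.mem_nhds (hmem s hs))
    refine DifferentiableAt.mul (DifferentiableAt.inv (by fun_prop) (pow_ne_zero _ h0)) ?_
    exact DifferentiableAt.comp (g := q) s h1 (by fun_prop)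
  have hsub' : Metric.ball (0 : ℂ) R ⊆ Metric.closedBall 0 R := Metric.ball_subset_closedBall
  set φ : ℂ → Pts n a lam := fun s => if s = 0 then OnePoint.infty else
    mkPt (s ^ 2 ^ n)⁻¹ ((s ^ M)⁻¹ * q (s ^ 2 ^ n)) with hφ
  have hφ0 : φ 0 = OnePoint.infty := by simp [hφ]
  have hφ1 : ∀ s, s ≠ 0 → φ s = mkPt (s ^ 2 ^ n)⁻¹ ((s ^ M)⁻¹ * q (s ^ 2 ^ n)) := by
    intro s hs; simp [hφ, hs]
  obtain ⟨e, he1, he2, he3⟩ := exists_openPartialHomeomorph φ R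
    (by
      intro s hs
      by_cases h0 : s = 0
      · subst h0
        rw [ContinuousWithinAt, hφ0]
        rw [OnePoint.hasBasis_nhds_infty.tendsto_right_iff]
        rintro K ⟨-, hK⟩
        obtain ⟨c, hc⟩ := hK.exists_bound_of_continuousOn
          (f := fun P : affineCurve n a lam => P.1.1) (by fun_prop)
        have hev : ∀ᶠ s : ℂ in 𝓝 0, ‖s ^ 2 ^ n‖ * (|c| + 1) < 1 := by
          have : ContinuousAt (fun s : ℂ => ‖s ^ 2 ^ n‖ * (|c| + 1)) 0 := by fun_prop
          apply this.eventually_lt continuousAt_const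
          simp
        filter_upwards [nhdsWithin_le_nhds hev, self_mem_nhdsWithin] with t ht htR
        by_cases ht0 : t = 0
        · right; rw [ht0, hφ0]; rfl
        · left
          rw [hφ1 t ht0, mkPt_of_mem (hcurve t htR ht0)]
          refine ⟨_, ?_, rfl⟩
          intro hmemK
          have h1 := hc _ hmemK
          simp only [norm_inv] at h1
          have h2 : 0 < ‖t ^ 2 ^ n‖ := norm_pos_iff.2 (pow_ne_zero _ ht0)
          have h3 : 1 ≤ c * ‖t ^ 2 ^ n‖ := by
            rwa [inv_le_iff_one_le_mul₀ h2] at h1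
          nlinarith [le_abs_self c]
      · have hc : ContinuousOn (fun s => (mkPt (s ^ 2 ^ n)⁻¹ ((s ^ M)⁻¹ * q (s ^ 2 ^ n)) :
            Pts n a lam)) (Metric.closedBall 0 R ∩ {0}ᶜ) :=
          continuousOn_mkPt (fun s hs => (hXd s hs.2).continuousAt.continuousWithinAt)
            (fun s hs => (hYd s hs.1 hs.2).continuousAt.continuousWithinAt)
            (fun s hs => hcurve s hs.1 hs.2)
        have h1 := hc s ⟨hs, h0⟩
        rw [continuousWithinAt_inter (isOpen_compl_singleton.mem_nhds h0)] at h1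
        refine h1.congr_of_eventuallyEq ?_ (hφ1 s h0)
        filter_upwards [nhdsWithin_le_nhds (isOpen_compl_singleton.mem_nhds h0)] with t ht
        exact hφ1 t ht)
    (by
      intro s hs t ht hst
      by_cases hs0 : s = 0
      · by_cases ht0 : t = 0
        · rw [hs0, ht0]
        · rw [hs0, hφ0, hφ1 t ht0] at hst
          exact absurd hst.symm (mkPt_ne_infty (hcurve t ht ht0))
      · by_cases ht0 : t = 0
        · rw [ht0, hφ0, hφ1 s hs0] at hst
          exact absurd hst (mkPt_ne_infty (hcurve s hs hs0))
        · rw [hφ1 s hs0, hφ1 t ht0] at hst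
          obtain ⟨h1, h2⟩ := mkPt_inj (hcurve s hs hs0) (hcurve t ht ht0) hst
          have h1' := inv_injective h1
          rw [h1'] at h2
          exact eq_of_pow_eq_pow hN hcop h1'
            (inv_injective (mul_right_cancel₀ (hqN _ (hmem t ht)).2 h2)))
    (by
      have hO := OnePoint.isOpen_compl_image_coe.2
        ⟨(isCompact_norm_le (n := n) (a := a) (lam := lam) (R ^ 2 ^ n)⁻¹).isClosed,
          isCompact_norm_le (R ^ 2 ^ n)⁻¹⟩
      convert hO using 1
      ext P
      constructor
      · rintro ⟨s, hs, rfl⟩ ⟨Q, hQ, hQs⟩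
        by_cases h0 : s = 0
        · rw [h0, hφ0] at hQs
          exact OnePoint.coe_ne_infty _ hQs
        · rw [hφ1 s h0, mkPt_of_mem (hcurve s (hsub' hs) h0)] at hQs
          have := OnePoint.coe_injective hQs
          subst this
          simp only [mem_ofPred_eq, norm_inv, norm_pow] at hQ
          have h2 : 0 < ‖s‖ := norm_pos_iff.2 h0
          have h3 : ‖s‖ < R := by simpa using hs
          have h4 := (inv_le_inv₀ (by positivity) (by positivity)).1 hQ
          exact absurd (pow_lt_pow_left₀ h3 h2.le hN) (not_lt.2 h4)
      · intro hP
        induction P using OnePoint.rec with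
        | infty => exact ⟨0, by simpa using hR, hφ0⟩
        | coe P =>
          obtain ⟨⟨x, y⟩, hxy⟩ := P
          have h1 : (R ^ 2 ^ n)⁻¹ < ‖x‖ := by
            by_contra! h
            exact hP ⟨_, h, rfl⟩
          have hxpos : 0 < ‖x‖ := lt_trans (by positivity) h1
          have hx0 : x ≠ 0 := norm_pos_iff.1 hxpos
          have h2 : ‖x⁻¹‖ < R ^ 2 ^ n := by
            rw [norm_inv]
            exact inv_lt_of_inv_lt₀ (by positivity) h1
          have hxb : x⁻¹ ∈ Metric.ball (0 : ℂ) ρ := by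
            have h2' := hRρ (R : ℂ) (by simp [abs_of_pos hR])
            rw [norm_pow, Complex.norm_real, Real.norm_of_nonneg hR.le] at h2'
            rw [mem_ball_zero_iff]
            exact h2.trans h2'
          have hy := mem_affineCurve.1 hxy
          simp only at hy
          have hri := rhs_inv (a := a) (lam := lam) (inv_ne_zero hx0)
          rw [inv_inv] at hri
          obtain ⟨hq1, hq2⟩ := hqN _ hxb
          obtain ⟨s, hs1, hs2⟩ := exists_pow_pow_eq hN1 hcop (z := x⁻¹) (w := q x⁻¹ / y)
            (inv_ne_zero hx0) (by
              have h3 : rhsInv a lam x⁻¹ ≠ 0 := by rw [← hq1]; exact pow_ne_zero _ hq2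
              rw [div_pow, hq1, hy, hri, ← hM, div_mul_eq_div_div_swap, div_self h3, one_div, inv_inv])
          have hs0 : s ≠ 0 := by
            rintro rfl
            rw [zero_pow hN] at hs1
            exact inv_ne_zero hx0 hs1.symm
          refine ⟨s, ?_, ?_⟩
          · rw [← hs1, norm_pow] at h2
            simpa using lt_of_pow_lt_pow_left₀ _ hR.le h2
          · have h5 : (s ^ M)⁻¹ * q x⁻¹ = y := by
              rw [hs2, inv_div, div_mul_cancel₀ _ hq2]
            rw [hφ1 s hs0, hs1, inv_inv, h5]
            exact mkPt_of_mem hxy)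
  refine ⟨e, ?_, isChart_of (X := fun s => (s ^ 2 ^ n)⁻¹)
    (Y := fun s => (s ^ M)⁻¹ * q (s ^ 2 ^ n)) ?_⟩
  · rw [he1]
    exact ⟨0, by simpa using hR, hφ0⟩
  · intro s hs hsi
    rw [he2] at hs
    rw [he3] at hsi ⊢
    have h0 : s ≠ 0 := by rintro rfl; exact hsi hφ0
    exact ⟨hφ1 s h0, hcurve s (hsub' hs) h0, hXd s h0, hYd s (hsub' hs) h0⟩

theorem exists_factor (ha : Odd a) (h0 : lam ≠ 0) (h1 : lam ^ 4 ≠ 1) {p : ℂ}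
    (hp : rhs a lam p = 0) : ∃ m : ℕ, Odd m ∧ ∃ r : ℂ → ℂ, Differentiable ℂ r ∧ r p ≠ 0 ∧
      ∀ x, rhs a lam x = (x - p) ^ m * r x := by
  have ha0 : a ≠ 0 := by rintro rfl; simp at ha
  have hl2 : lam ^ 2 ≠ 1 := by
    intro h; apply h1; rw [show lam ^ 4 = (lam ^ 2) ^ 2 by ring, h, one_pow]
  have hl20 : lam ^ 2 ≠ 0 := pow_ne_zero _ h0
  have hli : lam ^ 2 ≠ (lam ^ 2)⁻¹ := by
    intro h
    apply h1
    calc lam ^ 4 = lam ^ 2 * lam ^ 2 := by ring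
      _ = lam ^ 2 * (lam ^ 2)⁻¹ := by rw [← h]
      _ = 1 := mul_inv_cancel₀ hl20
  have hl1 : (lam ^ 2)⁻¹ ≠ 1 := by
    intro h; exact hl2 (inv_eq_one.1 h)
  have hcases : p = 0 ∨ p ^ 2 = 1 ∨ p ^ 2 = lam ^ 2 ∨ p ^ 2 = (lam ^ 2)⁻¹ := by
    simp only [rhs, mul_eq_zero, pow_eq_zero_iff ha0, sub_eq_zero] at hp
    tauto
  rcases hcases with rfl | h | h | h
  · refine ⟨a, ha, fun x => (x ^ 2 - 1) ^ a * (x ^ 2 - lam ^ 2) * (x ^ 2 - (lam ^ 2)⁻¹),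
      by fun_prop, ?_, fun x => ?_⟩
    · simp [h0, ha0]
    · simp only [rhs]; ring
  all_goals have hp0 : p ≠ 0 := by
              rintro rfl
              rw [zero_pow two_ne_zero] at h
              simp [hl20.symm] at h
  all_goals have hpp : p + p ≠ 0 := by
              rw [← two_mul]; exact mul_ne_zero two_ne_zero hp0
  · refine ⟨a, ha, fun x => x ^ a * (x + p) ^ a * (x ^ 2 - lam ^ 2) * (x ^ 2 - (lam ^ 2)⁻¹),
      by fun_prop, ?_, fun x => ?_⟩
    · simp only [h, ne_eq, mul_eq_zero, pow_eq_zero_iff ha0, sub_eq_zero]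
      push Not
      exact ⟨⟨⟨hp0, hpp⟩, hl2.symm⟩, hl1.symm⟩
    · rw [rhs, show x ^ 2 - 1 = (x - p) * (x + p) by rw [← h]; ring, mul_pow]; ring
  · refine ⟨1, odd_one, fun x => x ^ a * (x ^ 2 - 1) ^ a * (x + p) * (x ^ 2 - (lam ^ 2)⁻¹),
      by fun_prop, ?_, fun x => ?_⟩
    · simp only [h, ne_eq, mul_eq_zero, pow_eq_zero_iff ha0, sub_eq_zero]
      push Not
      exact ⟨⟨⟨hp0, hl2⟩, hpp⟩, hli⟩
    · rw [rhs, show x ^ 2 - lam ^ 2 = (x - p) * (x + p) by rw [← h]; ring]; ring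
  · refine ⟨1, odd_one, fun x => x ^ a * (x ^ 2 - 1) ^ a * (x ^ 2 - lam ^ 2) * (x + p),
      by fun_prop, ?_, fun x => ?_⟩
    · simp only [h, ne_eq, mul_eq_zero, pow_eq_zero_iff ha0, sub_eq_zero]
      push Not
      exact ⟨⟨⟨hp0, hl1⟩, hli.symm⟩, hpp⟩
    · rw [rhs, show x ^ 2 - (lam ^ 2)⁻¹ = (x - p) * (x + p) by rw [← h]; ring]; ring

/-- Every point lies in the domain of a chart. -/
theorem exists_chart (hn : 1 ≤ n) (ha : Odd a) (h0 : lam ≠ 0) (h1 : lam ^ 4 ≠ 1)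
    (P : Pts n a lam) :
    ∃ e : OpenPartialHomeomorph (Pts n a lam) ℂ, P ∈ e.source ∧ IsChart e := by
  induction P using OnePoint.rec with
  | infty => exact exists_chart_infty hn ha
  | coe P =>
    by_cases hP : rhs a lam P.1.1 = 0
    · obtain ⟨m, hm, r, hr, hrp, hg⟩ := exists_factor ha h0 h1 hP
      exact exists_chart_ramified hn hm hr hrp hg P rfl
    · exact exists_chart_unramified P hP

theorem finite_fibre (x : ℂ) : {P : Pts n a lam | P ≠ OnePoint.infty ∧ xCoord P = x}.Finite := by
  have hN : 2 ^ n ≠ 0 := by positivity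
  refine Finite.subset ((finite_roots hN (rhs a lam x)).image (fun y => (mkPt x y : Pts n a lam))) ?_
  rintro P ⟨hP, rfl⟩
  induction P using OnePoint.rec with
  | infty => exact absurd rfl hP
  | coe P => exact ⟨P.1.2, mem_affineCurve.1 P.2, mkPt_of_mem _⟩

/-- Coordinate changes between charts are holomorphic. -/
theorem differentiableOn_transition {e e' : OpenPartialHomeomorph (Pts n a lam) ℂ}
    (he : IsChart e) (he' : IsChart e') :
    DifferentiableOn ℂ (e.symm ≫ₕ e') (e.symm ≫ₕ e').source := by
  set T := e.symm ≫ₕ e' with hT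
  have hop : ∀ f : OpenPartialHomeomorph (Pts n a lam) ℂ,
      IsOpen {s | s ∈ f.target ∧ f.symm s ≠ OnePoint.infty} := fun f =>
    f.isOpen_inter_preimage_symm (s := {OnePoint.infty}ᶜ) isOpen_compl_singleton
  have hTe : ∀ s ∈ T.source, e'.symm (T s) = e.symm s := by
    intro s hs
    have : e.symm s ∈ e'.source := by
      simpa [hT] using (show s ∈ (e.symm ≫ₕ e').source from hs).2
    exact e'.left_inv this
  have hTs : ∀ s ∈ T.source, s ∈ e.target := fun s hs => by
    simpa using (show s ∈ (e.symm ≫ₕ e').source from hs).1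
  have hTt : ∀ s ∈ T.source, T s ∈ e'.target := fun s hs => by
    have := T.map_source hs
    simpa using (show T s ∈ (e.symm ≫ₕ e').target from this).1
  have hcont : ∀ s ∈ T.source, ContinuousAt T s := fun s hs => T.continuousAt hs
  have hpunct : ∀ s ∈ T.source, Tendsto T (𝓝[≠] s) (𝓝[≠] (T s)) := by
    intro s hs
    refine tendsto_nhdsWithin_iff.2 ⟨(hcont s hs).tendsto.mono_left nhdsWithin_le_nhds, ?_⟩
    filter_upwards [nhdsWithin_le_nhds (T.open_source.mem_nhds hs), self_mem_nhdsWithin] with t ht h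
    exact fun h' => h (T.injOn ht hs h')
  set F : ℂ → ℂ := fun t => xCoord (e'.symm t) with hF
  have hfin : ∀ s ∈ T.source, e.symm s ≠ OnePoint.infty → DifferentiableAt ℂ T s := by
    intro s hs hsi
    have hFan : ∀ t ∈ {t | t ∈ e'.target ∧ e'.symm t ≠ OnePoint.infty}, AnalyticAt ℂ F t :=
      fun t ht => he'.1.analyticAt ((hop e').mem_nhds ht)
    have hTm : T s ∈ {t | t ∈ e'.target ∧ e'.symm t ≠ OnePoint.infty} :=
      ⟨hTt s hs, by rw [hTe s hs]; exact hsi⟩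
    have hnz : ∀ᶠ t in 𝓝[≠] (T s), deriv F t ≠ 0 := by
      refine (hFan _ hTm).deriv.eventually_eq_zero_or_eventually_ne_zero.resolve_left ?_
      intro hz
      obtain ⟨ε, hε, hb⟩ := Metric.eventually_nhds_iff_ball.1 (hz.and ((hop e').mem_nhds hTm))
      have hconst : ∀ t ∈ Metric.ball (T s) ε, F t = F (T s) := by
        intro t ht
        refine (convex_ball (T s) ε).is_const_of_fderivWithin_eq_zero (𝕜 := ℂ)
          (fun u hu => (hFan u (hb u hu).2).differentiableAt.differentiableWithinAt) ?_ ht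
          (Metric.mem_ball_self hε)
        intro u hu
        rw [fderivWithin_of_isOpen Metric.isOpen_ball hu]
        ext
        simpa using (hb u hu).1
      have hinf : (Metric.ball (T s) ε).Infinite :=
        infinite_of_mem_nhds (T s) (Metric.ball_mem_nhds _ hε)
      refine hinf (Finite.of_finite_image (f := e'.symm) ?_ ?_)
      · refine (finite_fibre (F (T s))).subset ?_
        rintro _ ⟨t, ht, rfl⟩
        exact ⟨(hb t ht).2.2, hconst t ht⟩
      · exact e'.symm.injOn.mono (fun t ht => (hb t ht).2.1)
    refine (Complex.analyticAt_of_differentiable_on_punctured_nhds_of_continuousAt ?_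
      (hcont s hs)).differentiableAt
    have hopen : ∀ᶠ t in 𝓝 s, t ∈ T.source ∧ t ∈ {t | t ∈ e.target ∧ e.symm t ≠ OnePoint.infty} :=
      Filter.inter_mem (T.open_source.mem_nhds hs) ((hop e).mem_nhds ⟨hTs s hs, hsi⟩)
    filter_upwards [(hpunct s hs).eventually hnz, nhdsWithin_le_nhds hopen] with t ht htm
    obtain ⟨ht1, ht2⟩ := htm
    have hTm' : T t ∈ {t | t ∈ e'.target ∧ e'.symm t ≠ OnePoint.infty} :=
      ⟨hTt t ht1, by rw [hTe t ht1]; exact ht2.2⟩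
    have hstrict : HasStrictDerivAt F (deriv F (T t)) (T t) :=
      (hFan _ hTm').hasStrictDerivAt
    have hG : DifferentiableAt ℂ (fun u => xCoord (e.symm u)) t :=
      he.1.differentiableAt ((hop e).mem_nhds ht2)
    have hFT : F (T t) = xCoord (e.symm t) := by simp only [hF, hTe t ht1]
    have hL := (hstrict.to_localInverse ht).hasDerivAt.differentiableAt
    rw [hFT] at hL
    refine (hL.comp t hG).congr_of_eventuallyEq ?_
    filter_upwards [(hcont t ht1).eventually (hstrict.eventually_left_inverse ht),
      T.open_source.mem_nhds ht1] with u hu hu1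
    rw [Function.comp_apply, ← hTe u hu1]
    exact hu.symm
  intro s hs
  refine DifferentiableAt.differentiableWithinAt ?_
  by_cases hsi : e.symm s = OnePoint.infty
  · refine (Complex.analyticAt_of_differentiable_on_punctured_nhds_of_continuousAt ?_
      (hcont s hs)).differentiableAt
    filter_upwards [nhdsWithin_le_nhds (T.open_source.mem_nhds hs), self_mem_nhdsWithin] with t ht h
    refine hfin t ht (fun h' => h ?_)
    exact e.symm.injOn (hTs t ht) (hTs s hs) (h'.trans hsi.symm)
  · exact hfin s hs hsi

end

/-- The compact Riemann surface `S_{a,λ}`: the normalization of the projective closure of the curve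
`f_{a,λ}(x,y) = 0`. -/
def Surface (n a : ℕ) (lam : ℂ) (_hn : 1 ≤ n) (_ha : Odd a) (_h0 : lam ≠ 0) (_h1 : lam ^ 4 ≠ 1) :
    Type := Pts n a lam

section
variable (n a : ℕ) (lam : ℂ) (hn : 1 ≤ n) (ha : Odd a) (h0 : lam ≠ 0) (h1 : lam ^ 4 ≠ 1)

instance : TopologicalSpace (Surface n a lam hn ha h0 h1) :=
  inferInstanceAs (TopologicalSpace (Pts n a lam))

instance : CompactSpace (Surface n a lam hn ha h0 h1) :=
  inferInstanceAs (CompactSpace (Pts n a lam))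

instance : T2Space (Surface n a lam hn ha h0 h1) :=
  inferInstanceAs (T2Space (Pts n a lam))

instance : ChartedSpace ℂ (Surface n a lam hn ha h0 h1) where
  atlas := {e : OpenPartialHomeomorph (Pts n a lam) ℂ | IsChart e}
  chartAt P := (exists_chart hn ha h0 h1 P).choose
  mem_chart_source P := (exists_chart hn ha h0 h1 P).choose_spec.1
  chart_mem_atlas P := (exists_chart hn ha h0 h1 P).choose_spec.2

instance : IsManifold 𝓘(ℂ) ω (Surface n a lam hn ha h0 h1) := by
  refine isManifold_of_contDiffOn _ _ _ fun e e' he he' => ?_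
  have := (differentiableOn_transition he he').contDiffOn (n := ω) (e.symm ≫ₕ e').open_source
  simp only [modelWithCornersSelf_coe, modelWithCornersSelf_coe_symm, Set.range_id, Set.inter_univ]
  exact this

end

/-- `ω_N = exp (2πi / N)`. -/
def rootOfUnity (N : ℕ) : ℂ := Complex.exp (2 * Real.pi * Complex.I / N)

section
variable {n a : ℕ} {lam : ℂ}

theorem rootOfUnity_pow (n : ℕ) : rootOfUnity (2 ^ (n + 1)) ^ 2 ^ n = -1 := by
  rw [rootOfUnity, ← Complex.exp_nat_mul, ← Complex.exp_pi_mul_I]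
  congr 1
  have : (2 : ℂ) ^ n ≠ 0 := pow_ne_zero _ two_ne_zero
  push_cast
  rw [pow_succ]
  field_simp

theorem zero_mem_affineCurve (ha : Odd a) : ((0 : ℂ), (0 : ℂ)) ∈ affineCurve n a lam := by
  have ha0 : a ≠ 0 := by rintro rfl; simp at ha
  rw [mem_affineCurve]
  simp [rhs, ha0]

theorem tau₁_mem (ha : Odd a) (p : affineCurve n a lam) :
    (-p.1.1, rootOfUnity (2 ^ (n + 1)) * p.1.2) ∈ affineCurve n a lam := by
  have := mem_affineCurve.1 p.2
  rw [mem_affineCurve]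
  simp only
  rw [mul_pow, rootOfUnity_pow, this, rhs, rhs, ha.neg_pow, neg_sq]
  ring

theorem tau₂_mem {c : ℕ} (hn : 1 ≤ n) (ha : Odd a) (h0 : lam ≠ 0)
    (hc : c * 2 ^ (n - 1) = 2 * a + 2) (p : affineCurve n a lam) (hp : p.1.1 ≠ 0) :
    (1 / p.1.1, rootOfUnity (2 ^ (n + 1)) * p.1.2 / p.1.1 ^ c) ∈ affineCurve n a lam := by
  have := mem_affineCurve.1 p.2
  rw [mem_affineCurve]
  have hc' : c * 2 ^ n = (3 * a + 4) + a := by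
    obtain ⟨k, rfl⟩ := Nat.exists_eq_add_of_le' hn
    rw [Nat.add_sub_cancel] at hc
    rw [pow_succ, ← mul_assoc, hc]
    ring
  have hl : lam ^ 2 * (lam ^ 2)⁻¹ = 1 := mul_inv_cancel₀ (pow_ne_zero _ h0)
  simp only
  rw [div_pow, mul_pow, rootOfUnity_pow, this, one_div, rhs_inv hp, ← pow_mul, hc', pow_add]
  have key : rhs a lam p.1.1 = - (p.1.1 ^ a * rhsInv a lam p.1.1) := by
    have e : (1 - p.1.1 ^ 2) ^ a = - (p.1.1 ^ 2 - 1) ^ a := by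
      rw [← ha.neg_pow]; congr 1; ring
    rw [rhs, rhsInv, e]
    linear_combination (p.1.1 ^ a * (p.1.1 ^ 2 - 1) ^ a * (1 - p.1.1 ^ 4)) * hl
  rw [key]
  field_simp

end

/-- The self-map `τ₁(x, y) = (-x, ω y)`, `ω = ω_{2^(n+1)}`, fixing the point at infinity. -/
def tau₁ (n a : ℕ) (lam : ℂ) (hn : 1 ≤ n) (ha : Odd a) (h0 : lam ≠ 0) (h1 : lam ^ 4 ≠ 1)
    (P : Surface n a lam hn ha h0 h1) : Surface n a lam hn ha h0 h1 :=
  OnePoint.elim (X := affineCurve n a lam) (Y := Pts n a lam) P OnePoint.infty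
    (fun p : affineCurve n a lam =>
      OnePoint.some (X := affineCurve n a lam)
        ⟨(-p.1.1, rootOfUnity (2 ^ (n + 1)) * p.1.2), tau₁_mem ha p⟩)

open Classical in
/-- The self-map `τ₂(x, y) = (1/x, ω y / x^c)`, `ω = ω_{2^(n+1)}`, where `c 2^(n-1) = 2a + 2`; it
interchanges the points `(0, 0)` and infinity. -/
def tau₂ (n a c : ℕ) (lam : ℂ) (hn : 1 ≤ n) (ha : Odd a) (h0 : lam ≠ 0) (h1 : lam ^ 4 ≠ 1)
    (hc : c * 2 ^ (n - 1) = 2 * a + 2)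
    (P : Surface n a lam hn ha h0 h1) : Surface n a lam hn ha h0 h1 :=
  OnePoint.elim (X := affineCurve n a lam) (Y := Pts n a lam) P
    (OnePoint.some (X := affineCurve n a lam) ⟨(0, 0), zero_mem_affineCurve ha⟩)
    (fun p : affineCurve n a lam =>
      if hp : p.1.1 = 0 then OnePoint.infty
      else OnePoint.some (X := affineCurve n a lam)
        ⟨(1 / p.1.1, rootOfUnity (2 ^ (n + 1)) * p.1.2 / p.1.1 ^ c), tau₂_mem hn ha h0 hc p hp⟩)

/-- The group `Aut(M)` of biholomorphic self-maps of a Riemann surface `M`. -/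
def Aut (M : Type*) [TopologicalSpace M] [ChartedSpace ℂ M] : Subgroup (Equiv.Perm M) where
  carrier := {σ | MDifferentiable 𝓘(ℂ) 𝓘(ℂ) σ ∧ MDifferentiable 𝓘(ℂ) 𝓘(ℂ) σ.symm}
  mul_mem' h h' := ⟨h.1.comp h'.1, h'.2.comp h.2⟩
  one_mem' := ⟨mdifferentiable_id, mdifferentiable_id⟩
  inv_mem' h := ⟨h.2, h.1⟩

end TwoPowerCurve

end

/-! Automorphisms. A chart is a local homeomorphism in which `x` and `y` are holomorphic off
infinity. So a homeomorphism that is holomorphic in `x`, `y` away from infinity and its preimage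
carries charts to charts; at the parameter where the source point is infinity, continuity and
removable singularities suffice (`IsChart.homeomorph_symm_trans`). Since transition maps between
charts are holomorphic, the homeomorphism is biholomorphic. A map of finite order has a power of
itself as inverse, so continuity and coordinate formulas are all that must be checked
(`exists_aut_of_coord`).

Relations. Write `ζ` for the root of unity. The power `τ₁ ^ 2 ^ n` is `(x, y) ↦ (x, -y)`, so `τ₁`
has order `2 ^ (n + 1)`. Both squares are `(x, y) ↦ (x, ζ² y)`, so `τ₂² = τ₁²` and `τ₂` has the same
order. Comparing coordinates, `τ₂ τ₁ = τ₁ ^ r τ₂` holds for odd `r` with `ζ ^ r = (-1) ^ c ζ`: take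
`r = 1` for even `c` and `r = 2 ^ n + 1` for odd `c`. Powers of `τ₁` act on `x` by a sign while `τ₂`
inverts it, so `τ₂` is not a power of `τ₁`.

Group structure. The element `τ₂` itself need not be an involution, but `(τ₁ ^ k τ₂)² = τ₁ ^ (k + r
k + 2)`. Whenever `2 ^ (n + 1)` divides this exponent, `τ₁ ^ k τ₂` is an involution generating,
together with `τ₁`, the same group, and the extension splits
(`closure_pair_mulEquiv_semidirectProduct_of_sq`). For `r = 1` take `k ≡ -1`; for `r = 2 ^ n + 1`
take `k = 2 ^ (n - 1) - 1`, where the exponent is `2 ^ (2n - 1)`. Odd `c` forces `n ≥ 3`, because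
`4` divides `2a + 2`. -/

/-! ### Group theory: split extensions of a cyclic group by an involution. -/

theorem exists_zmod_monoidHom {G : Type*} [Group G] {k : ℕ} {u : G} (hu : u ^ k = 1) :
    ∃ f : Multiplicative (ZMod k) →* G,
      ∀ i : ℤ, f (Multiplicative.ofAdd (i : ZMod k)) = u ^ i := by
  have h0 : zmultiplesHom _ (Additive.ofMul u) (k : ℤ) = 0 := by
    simp only [zmultiplesHom_apply]
    rw [← ofMul_zpow, ← ofMul_one, zpow_natCast, hu]
  refine ⟨AddMonoidHom.toMultiplicativeLeft (ZMod.lift k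
    ⟨zmultiplesHom _ (Additive.ofMul u), h0⟩), fun i => ?_⟩
  change Additive.toMul (ZMod.lift k ⟨zmultiplesHom _ (Additive.ofMul u), h0⟩ (i : ZMod k)) = _
  rw [ZMod.lift_coe]
  simp

/-- Since `r * r = 1`, multiplication by `r` is its own inverse, hence an additive automorphism of
order dividing 2. -/
theorem exists_zmodTwo_mulAut (m : ℕ) (r : ZMod m) (hr : r * r = 1) :
    ∃ h : Multiplicative (ZMod 2) →* MulAut (Multiplicative (ZMod m)),
      ∀ z : ZMod m, h (Multiplicative.ofAdd 1) (Multiplicative.ofAdd z) =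
        Multiplicative.ofAdd (r * z) := by
  let e : MulAut (Multiplicative (ZMod m)) :=
    { toFun := fun z => Multiplicative.ofAdd (r * z.toAdd)
      invFun := fun z => Multiplicative.ofAdd (r * z.toAdd)
      left_inv := fun z => by simp [← mul_assoc, hr]
      right_inv := fun z => by simp [← mul_assoc, hr]
      map_mul' := fun z w => by simp [mul_add] }
  have he : e ^ 2 = 1 := by
    rw [sq]
    exact MulEquiv.ext e.left_inv
  obtain ⟨h, hh⟩ := exists_zmod_monoidHom he
  have h1 : h (Multiplicative.ofAdd 1) = e := by simpa using hh 1
  exact ⟨h, fun z => by rw [h1]; rfl⟩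

/-- A group generated by an element `s` of order `m` and an involution `t` outside `⟨s⟩` with
`t s = s ^ r t` is a semidirect product. -/
theorem closure_pair_mulEquiv_semidirectProduct {m r : ℕ} {G : Type*} [Group G] {s t : G}
    (hs : orderOf s = m) (ht : t * t = 1) (hst : t * s = s ^ r * t)
    (hts : t ∉ Subgroup.zpowers s)
    (h : Multiplicative (ZMod 2) →* MulAut (Multiplicative (ZMod m)))
    (hh : ∀ z : ZMod m, h (Multiplicative.ofAdd 1) (Multiplicative.ofAdd z) =
      Multiplicative.ofAdd (r * z)) :
    Nonempty (Subgroup.closure {s, t} ≃* Multiplicative (ZMod m) ⋊[h] Multiplicative (ZMod 2)) := by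
  obtain ⟨f, hf⟩ := exists_zmod_monoidHom (hs ▸ pow_orderOf_eq_one s)
  obtain ⟨g, hg⟩ := exists_zmod_monoidHom (show t ^ 2 = 1 by rw [sq, ht])
  have hg1 : g (Multiplicative.ofAdd 1) = t := by simpa using hg 1
  have hconj : ∀ i : ℤ, t * s ^ i * t⁻¹ = s ^ (r * i) := by
    intro i
    rw [← conj_zpow, hst, mul_inv_cancel_right, zpow_mul, zpow_natCast]
  have hcases : ∀ b : Multiplicative (ZMod 2), b = 1 ∨ b = Multiplicative.ofAdd 1 := by decide
  -- The compatibility required by `SemidirectProduct.lift`: conjugation by `t` is the `r`-th power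
  -- map on powers of `s`.
  have hcomp : ∀ b, f.comp (h b).toMonoidHom = (MulAut.conj (g b)).toMonoidHom.comp f := by
    intro b
    refine MonoidHom.ext fun z => ?_
    obtain ⟨z, rfl⟩ := Multiplicative.ofAdd.surjective z
    obtain ⟨i, rfl⟩ := ZMod.intCast_surjective z
    rcases hcases b with rfl | rfl
    · simp
    · have : ((r : ZMod m) * (i : ZMod m)) = ((r * i : ℤ) : ZMod m) := by push_cast; rfl
      simp only [MonoidHom.comp_apply, MulEquiv.toMonoidHom_eq_coe, MonoidHom.coe_coe, hh, this,
        MulAut.conj_apply, hg1, hf, hconj]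
  let F := SemidirectProduct.lift f g hcomp
  have hF : ∀ x, F x = f x.left * g x.right := fun x => rfl
  -- A kernel element gives either `s ^ i = 1`, so that `m` divides `i`, or `s ^ i * t = 1`, which
  -- would put `t` in the group generated by `s`.
  have hinj : Function.Injective F := by
    rw [injective_iff_map_eq_one]
    rintro ⟨z, b⟩ hx
    rw [hF] at hx
    obtain ⟨z, rfl⟩ := Multiplicative.ofAdd.surjective z
    obtain ⟨i, rfl⟩ := ZMod.intCast_surjective z
    simp only [hf] at hx
    rcases hcases b with rfl | rfl
    · rw [map_one, mul_one, ← orderOf_dvd_iff_zpow_eq_one, hs] at hx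
      rw [(ZMod.intCast_zmod_eq_zero_iff_dvd i m).2 hx]
      rfl
    · rw [hg1] at hx
      exact absurd ⟨-i, by simpa using (eq_inv_of_mul_eq_one_right hx).symm⟩ hts
  have hrange : F.range = Subgroup.closure {s, t} := by
    apply le_antisymm
    · rintro _ ⟨⟨z, b⟩, rfl⟩
      rw [hF]
      obtain ⟨z, rfl⟩ := Multiplicative.ofAdd.surjective z
      obtain ⟨i, rfl⟩ := ZMod.intCast_surjective z
      simp only [hf]
      refine mul_mem (zpow_mem (Subgroup.subset_closure (by simp)) i) ?_
      rcases hcases b with rfl | rfl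
      · rw [map_one]; exact one_mem _
      · rw [hg1]; exact Subgroup.subset_closure (by simp)
    · rw [Subgroup.closure_le]
      rintro x (rfl | rfl)
      · refine ⟨⟨Multiplicative.ofAdd ((1 : ℤ) : ZMod m), 1⟩, ?_⟩
        rw [hF]
        simp only [hf, map_one, mul_one, zpow_one]
      · refine ⟨⟨1, Multiplicative.ofAdd 1⟩, ?_⟩
        rw [hF]
        simp only [hg1, map_one, one_mul]
  exact ⟨(MulEquiv.subgroupCongr hrange.symm).trans (MonoidHom.ofInjective hinj).symm⟩

/-- Allows the second generator to be replaced by an involution in the same coset of the powers of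
`s`. -/
theorem closure_pair_pow_mul {G : Type*} [Group G] (s t : G) (k : ℕ) :
    Subgroup.closure {s, s ^ k * t} = Subgroup.closure {s, t} := by
  apply le_antisymm
  · rw [Subgroup.closure_le]
    have h1 : s ∈ Subgroup.closure {s, t} := Subgroup.subset_closure (by simp)
    rintro x (rfl | rfl)
    · exact h1
    · exact mul_mem (pow_mem h1 k) (Subgroup.subset_closure (by simp))
  · rw [Subgroup.closure_le]
    have h1 : s ∈ Subgroup.closure {s, s ^ k * t} := Subgroup.subset_closure (by simp)
    rintro x (rfl | rfl)
    · exact h1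
    · have := mul_mem (inv_mem (pow_mem h1 k))
        (Subgroup.subset_closure (show s ^ k * x ∈ ({s, s ^ k * x} : Set G) by simp))
      simpa using this

theorem mul_pow_eq_pow_mul_of_mul_eq {G : Type*} [Group G] {s t : G} {r k : ℕ}
    (h : t * s = s ^ r * t) : t * s ^ k = s ^ (r * k) * t := by
  rw [← mul_inv_eq_iff_eq_mul, ← conj_pow, h, mul_inv_cancel_right, pow_mul]

/-- A group generated by an element `s` of order `m` and `t` outside `⟨s⟩` with `t s = s ^ r t` and
`t ^ 2 = s ^ 2` is a semidirect product if `s ^ k t` is an involution for some `k`. -/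
theorem closure_pair_mulEquiv_semidirectProduct_of_sq {m r k : ℕ} {G : Type*} [Group G] {s t : G}
    (hs : orderOf s = m) (ht : t * t = s * s) (hst : t * s = s ^ r * t)
    (hts : t ∉ Subgroup.zpowers s) (hk : m ∣ k + r * k + 2)
    (h : Multiplicative (ZMod 2) →* MulAut (Multiplicative (ZMod m)))
    (hh : ∀ z : ZMod m, h (Multiplicative.ofAdd 1) (Multiplicative.ofAdd z) =
      Multiplicative.ofAdd (r * z)) :
    Nonempty (Subgroup.closure {s, t} ≃* Multiplicative (ZMod m) ⋊[h] Multiplicative (ZMod 2)) := by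
  rw [← closure_pair_pow_mul s t k]
  refine closure_pair_mulEquiv_semidirectProduct hs ?_ ?_ ?_ h hh
  -- Moving `t` past `s ^ k` multiplies the exponent by `r`, and `t * t` contributes the remaining
  -- `s ^ 2`.
  · calc s ^ k * t * (s ^ k * t) = s ^ k * (t * s ^ k) * t := by group
      _ = s ^ k * s ^ (r * k) * (t * t) := by rw [mul_pow_eq_pow_mul_of_mul_eq hst]; group
      _ = s ^ (k + r * k + 2) := by rw [ht, pow_add, pow_add, sq]
      _ = 1 := by rw [← orderOf_dvd_iff_pow_eq_one, hs]; exact hk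
  -- The new generator conjugates `s` exactly as `t` does, because `s ^ k` commutes with `s`.
  · rw [mul_assoc, hst, ← mul_assoc, ← mul_assoc, ← pow_add, ← pow_add, add_comm]
  · intro hmem
    refine hts ?_
    have := mul_mem (inv_mem (pow_mem (Subgroup.mem_zpowers s) k)) hmem
    simpa using this
-- Topology of the surface in terms of the coordinates.
noncomputable section
open Set Filter Topology
open scoped Manifold ContDiff
namespace TwoPowerCurve
section
variable {n a : ℕ} {lam : ℂ}

theorem continuousAt_xCoord {P : Pts n a lam} (hP : P ≠ OnePoint.infty) :
    ContinuousAt (xCoord : Pts n a lam → ℂ) P := by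
  induction P using OnePoint.rec with
  | infty => exact absurd rfl hP
  | coe p =>
    rw [OnePoint.continuousAt_coe]
    exact (continuous_fst.comp continuous_subtype_val).continuousAt

theorem continuousAt_yCoord {P : Pts n a lam} (hP : P ≠ OnePoint.infty) :
    ContinuousAt (yCoord : Pts n a lam → ℂ) P := by
  induction P using OnePoint.rec with
  | infty => exact absurd rfl hP
  | coe p =>
    rw [OnePoint.continuousAt_coe]
    exact (continuous_snd.comp continuous_subtype_val).continuousAt

theorem yCoord_pow {P : Pts n a lam} (hP : P ≠ OnePoint.infty) :
    yCoord P ^ 2 ^ n = rhs a lam (xCoord P) := by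
  induction P using OnePoint.rec with
  | infty => exact absurd rfl hP
  | coe p => exact mem_affineCurve.1 p.2

/-- The condition at infinity is needed because the junk coordinates of infinity are those of `(0,
0)`. -/
theorem Pts.ext {P Q : Pts n a lam} (h : P = OnePoint.infty ↔ Q = OnePoint.infty)
    (hx : xCoord P = xCoord Q) (hy : yCoord P = yCoord Q) : P = Q := by
  induction P using OnePoint.rec with
  | infty => exact (h.1 rfl).symm
  | coe p =>
    induction Q using OnePoint.rec with
    | infty => exact h.2 rfl
    | coe q => exact congrArg _ (Subtype.ext (Prod.ext hx hy))

/-- A bound on `x` bounds `y` through the equation, so the part of the affine curve with bounded `x`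
is compact and misses a neighbourhood of infinity. -/
theorem eventually_lt_norm_xCoord (c : ℝ) :
    ∀ᶠ P : Pts n a lam in 𝓝 OnePoint.infty, P ≠ OnePoint.infty → c < ‖xCoord P‖ := by
  have hK := isCompact_norm_le (n := n) (a := a) (lam := lam) c
  filter_upwards [(OnePoint.isOpen_compl_image_coe.2 ⟨hK.isClosed, hK⟩).mem_nhds
    OnePoint.infty_notMem_image_coe] with P hP hP'
  induction P using OnePoint.rec with
  | infty => exact absurd rfl hP'
  | coe p =>
    by_contra! h
    exact hP ⟨p, h, rfl⟩

/-- A basic neighbourhood of infinity is the complement of a compact part of the affine curve, on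
which `x` is bounded. -/
theorem tendsto_nhds_infty {β : Type*} {l : Filter β} {f : β → Pts n a lam}
    (h : ∀ c : ℝ, ∀ᶠ t in l, f t ≠ OnePoint.infty → c < ‖xCoord (f t)‖) :
    Tendsto f l (𝓝 OnePoint.infty) := by
  rw [OnePoint.hasBasis_nhds_infty.tendsto_right_iff]
  rintro K ⟨-, hK⟩
  obtain ⟨c, hc⟩ := hK.exists_bound_of_continuousOn
    (f := fun P : affineCurve n a lam => P.1.1) (by fun_prop)
  filter_upwards [h c] with t ht
  generalize f t = P at *
  induction P using OnePoint.rec with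
  | infty => right; rfl
  | coe p =>
    left
    exact ⟨p, fun hp => absurd (ht (OnePoint.coe_ne_infty p)) (not_lt.2 (hc p hp)), rfl⟩

theorem tendsto_nhds_of_coord {β : Type*} {l : Filter β} {f : β → Pts n a lam}
    {P : Pts n a lam} (hP : P ≠ OnePoint.infty) (hf : ∀ᶠ t in l, f t ≠ OnePoint.infty)
    (hx : Tendsto (fun t => xCoord (f t)) l (𝓝 (xCoord P)))
    (hy : Tendsto (fun t => yCoord (f t)) l (𝓝 (yCoord P))) : Tendsto f l (𝓝 P) := by
  induction P using OnePoint.rec with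
  | infty => exact absurd rfl hP
  | coe p =>
    classical
    -- A lift of `f` to the affine curve; the default `p` is used only where `f t` is infinity,
    -- which eventually does not happen.
    let g : β → affineCurve n a lam := fun t => (f t).elim p id
    have hg : ∀ t, f t ≠ OnePoint.infty → ((g t : affineCurve n a lam) : Pts n a lam) = f t := by
      intro t
      simp only [g]
      generalize f t = Q
      intro hQ
      induction Q using OnePoint.rec with
      | infty => exact absurd rfl hQ
      | coe q => rfl
    have hg' : Tendsto g l (𝓝 p) := by
      rw [tendsto_subtype_rng]
      refine (hx.prodMk_nhds hy).congr' ?_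
      filter_upwards [hf] with t ht
      rw [← hg t ht]
      rfl
    refine ((OnePoint.continuous_coe.tendsto p).comp hg').congr' ?_
    filter_upwards [hf] with t ht
    exact hg t ht

/-- Near a zero of `x` on the curve, `y` is determined by `x` up to a small error. -/
theorem tendsto_yCoord_zero {β : Type*} {l : Filter β} {f : β → Pts n a lam} {x₀ : ℂ}
    (h0 : rhs a lam x₀ = 0) (hf : ∀ᶠ t in l, f t ≠ OnePoint.infty)
    (hx : Tendsto (fun t => xCoord (f t)) l (𝓝 x₀)) :
    Tendsto (fun t => yCoord (f t)) l (𝓝 0) := by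
  have h1 : Tendsto (fun t => ‖rhs a lam (xCoord (f t))‖) l (𝓝 0) := by
    have := (((differentiable_rhs a lam).continuous.tendsto x₀).comp hx).norm
    rwa [h0, norm_zero] at this
  rw [tendsto_zero_iff_norm_tendsto_zero, Metric.tendsto_nhds]
  intro ε hε
  filter_upwards [h1.eventually_lt_const (pow_pos hε (2 ^ n)), hf] with t ht ht'
  rw [← yCoord_pow ht', norm_pow] at ht
  rw [Real.dist_eq, sub_zero, abs_norm]
  exact lt_of_pow_lt_pow_left₀ _ hε.le ht

/-! ### Holomorphy of self-maps given in coordinates. -/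

/-- A homeomorphism of the surface that is given by holomorphic functions `U`, `V` of the
coordinates `x`, `y` away from infinity and its preimage carries charts to charts. -/
theorem IsChart.homeomorph_symm_trans (g : Pts n a lam ≃ₜ Pts n a lam) {U V : ℂ × ℂ → ℂ}
    (hU : ∀ P, P ≠ OnePoint.infty → g P ≠ OnePoint.infty →
      xCoord (g P) = U (xCoord P, yCoord P) ∧ DifferentiableAt ℂ U (xCoord P, yCoord P))
    (hV : ∀ P, P ≠ OnePoint.infty → g P ≠ OnePoint.infty →
      yCoord (g P) = V (xCoord P, yCoord P) ∧ DifferentiableAt ℂ V (xCoord P, yCoord P))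
    {e : OpenPartialHomeomorph (Pts n a lam) ℂ} (he : IsChart e) :
    IsChart (g.symm.toOpenPartialHomeomorph.trans e) := by
  have hop : ∀ f : OpenPartialHomeomorph (Pts n a lam) ℂ,
      IsOpen {s | s ∈ f.target ∧ f.symm s ≠ OnePoint.infty} := fun f =>
    f.isOpen_inter_preimage_symm (s := {OnePoint.infty}ᶜ) isOpen_compl_singleton
  set e₁ := g.symm.toOpenPartialHomeomorph.trans e with he₁
  have htgt : e₁.target = e.target := by simp [he₁]
  have hsymm : ∀ s, e₁.symm s = g (e.symm s) := fun s => rfl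
  have key : ∀ (c : Pts n a lam → ℂ) (W : ℂ × ℂ → ℂ),
      (∀ P, P ≠ OnePoint.infty → ContinuousAt c P) →
      (∀ P, P ≠ OnePoint.infty → g P ≠ OnePoint.infty →
        c (g P) = W (xCoord P, yCoord P) ∧ DifferentiableAt ℂ W (xCoord P, yCoord P)) →
      DifferentiableOn ℂ (fun s => c (e₁.symm s))
        {s | s ∈ e₁.target ∧ e₁.symm s ≠ OnePoint.infty} := by
    intro c W hc hW
    have hfin : ∀ s ∈ {s | s ∈ e₁.target ∧ e₁.symm s ≠ OnePoint.infty},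
        e.symm s ≠ OnePoint.infty → DifferentiableAt ℂ (fun s => c (e₁.symm s)) s := by
      intro s hs hsi
      have hse : s ∈ {s | s ∈ e.target ∧ e.symm s ≠ OnePoint.infty} := ⟨htgt ▸ hs.1, hsi⟩
      have h1 := (he.1.differentiableAt ((hop e).mem_nhds hse)).prodMk
        (he.2.differentiableAt ((hop e).mem_nhds hse))
      refine (DifferentiableAt.comp s (hW _ hsi hs.2).2 h1).congr_of_eventuallyEq ?_
      filter_upwards [(hop e).mem_nhds hse, (hop e₁).mem_nhds hs] with t ht ht'
      exact (hW _ ht.2 ht'.2).1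
    intro s hs
    refine DifferentiableAt.differentiableWithinAt ?_
    -- Only one parameter of `e` can correspond to infinity. If `g` sends infinity to a finite
    -- point, the coordinate stays continuous there, so the singularity is removable.
    by_cases hsi : e.symm s = OnePoint.infty
    · have hcont : ContinuousAt (fun s => c (e₁.symm s)) s :=
        ContinuousAt.comp (g := c) (hc _ hs.2) (e₁.symm.continuousAt hs.1)
      refine (Complex.analyticAt_of_differentiable_on_punctured_nhds_of_continuousAt ?_
        hcont).differentiableAt
      filter_upwards [nhdsWithin_le_nhds ((hop e₁).mem_nhds hs), self_mem_nhdsWithin] with t ht h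
      refine hfin t ht (fun h' => h ?_)
      have ht' : t ∈ e.target := htgt ▸ ht.1
      have hs' : s ∈ e.target := htgt ▸ hs.1
      exact e.symm.injOn ht' hs' (h'.trans hsi.symm)
    · exact hfin s hs hsi
  exact ⟨key _ U (fun P hP => continuousAt_xCoord hP) hU,
    key _ V (fun P hP => continuousAt_yCoord hP) hV⟩

/-- Read in charts `e` and `e'`, the map is the transition from `e` to the pullback of `e'` along
`g`. The pullback is again a chart, so the transition is holomorphic. -/
theorem mdifferentiable_homeomorph {hn : 1 ≤ n} {ha : Odd a} {h0 : lam ≠ 0} {h1 : lam ^ 4 ≠ 1}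
    (g : Pts n a lam ≃ₜ Pts n a lam)
    (hg : ∀ e : OpenPartialHomeomorph (Pts n a lam) ℂ, IsChart e →
      IsChart (g.toOpenPartialHomeomorph.trans e))
    (f : Surface n a lam hn ha h0 h1 → Surface n a lam hn ha h0 h1)
    (hf : ∀ P : Pts n a lam, f P = g P) :
    MDifferentiable 𝓘(ℂ) 𝓘(ℂ) f := by
  have hcont : Continuous f := by
    have : f = g := funext hf
    rw [this]
    exact g.continuous
  intro P
  rw [mdifferentiableAt_iff]
  refine ⟨hcont.continuousAt, ?_⟩
  let e : OpenPartialHomeomorph (Pts n a lam) ℂ := chartAt (M := Surface n a lam hn ha h0 h1) ℂ P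
  let e' : OpenPartialHomeomorph (Pts n a lam) ℂ := chartAt (M := Surface n a lam hn ha h0 h1) ℂ (f P)
  have he : IsChart e := chart_mem_atlas ℂ P
  have he' : IsChart e' := chart_mem_atlas ℂ (f P)
  have hP : P ∈ e.source := mem_chart_source ℂ P
  have hP' : f P ∈ e'.source := mem_chart_source ℂ (f P)
  set T := e.symm ≫ₕ (g.toOpenPartialHomeomorph.trans e') with hT
  have hs : e P ∈ T.source := by
    have h2 : g (e.symm (e P)) = f P := (congrArg g (e.left_inv hP)).trans (hf P).symm
    simp only [hT, OpenPartialHomeomorph.trans_source, OpenPartialHomeomorph.symm_source,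
      Set.mem_inter_iff, Set.mem_preimage]
    refine ⟨e.map_source hP, trivial, ?_⟩
    change g (e.symm (e P)) ∈ e'.source
    rwa [h2]
  have hd : DifferentiableAt ℂ T (e P) :=
    (differentiableOn_transition he (hg e' he')).differentiableAt (T.open_source.mem_nhds hs)
  have hw : writtenInExtChartAt 𝓘(ℂ) 𝓘(ℂ) P f = T := by
    funext s
    exact congrArg e' (hf (e.symm s))
  rw [hw]
  exact hd.differentiableWithinAt

/-- A continuous self-map of finite order of the surface that is given by holomorphic functions
`U`, `V` of the coordinates `x`, `y` away from infinity and its preimage is an automorphism. -/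
theorem exists_aut_of_coord {hn : 1 ≤ n} {ha : Odd a} {h0 : lam ≠ 0} {h1 : lam ^ 4 ≠ 1}
    {f : Pts n a lam → Pts n a lam} (hf : Continuous f) {k : ℕ} (hk : k ≠ 0)
    (hfk : ∀ P, f^[k] P = P) {U V : ℂ × ℂ → ℂ}
    (hU : ∀ P, P ≠ OnePoint.infty → f P ≠ OnePoint.infty →
      xCoord (f P) = U (xCoord P, yCoord P) ∧ DifferentiableAt ℂ U (xCoord P, yCoord P))
    (hV : ∀ P, P ≠ OnePoint.infty → f P ≠ OnePoint.infty →
      yCoord (f P) = V (xCoord P, yCoord P) ∧ DifferentiableAt ℂ V (xCoord P, yCoord P)) :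
    ∃ τ : Aut (Surface n a lam hn ha h0 h1),
      ∀ P : Pts n a lam, (τ : Equiv.Perm (Surface n a lam hn ha h0 h1)) P = f P := by
  obtain ⟨k, rfl⟩ := Nat.exists_eq_succ_of_ne_zero hk
  let E : Pts n a lam ≃ Pts n a lam :=
    { toFun := f
      invFun := f^[k]
      left_inv := fun P => by rw [← Function.iterate_succ_apply]; exact hfk P
      right_inv := fun P => by rw [← Function.iterate_succ_apply' f]; exact hfk P }
  let g : Pts n a lam ≃ₜ Pts n a lam :=
    { toEquiv := E
      continuous_toFun := hf
      continuous_invFun := hf.iterate k }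
  let F : Equiv.Perm (Surface n a lam hn ha h0 h1) := E
  -- The formulas `U`, `V` for `f` show that pullback along `f⁻¹` preserves charts, which makes the
  -- inverse holomorphic. Then `F = F⁻¹ ^ k`, from `F ^ (k + 1) = 1`, makes `F` holomorphic as well.
  have hinv : MDifferentiable 𝓘(ℂ) 𝓘(ℂ) F.symm :=
    mdifferentiable_homeomorph g.symm (fun e he => he.homeomorph_symm_trans g hU hV) _
      (fun P => rfl)
  have hpow : ∀ j : ℕ, MDifferentiable 𝓘(ℂ) 𝓘(ℂ) (⇑(F⁻¹ ^ j)) := by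
    intro j
    induction j with
    | zero => exact mdifferentiable_id
    | succ j ih => rw [pow_succ]; exact ih.comp hinv
  have hF : F = F⁻¹ ^ k := by
    have h2 : F ^ (k + 1) = 1 := by
      ext P
      rw [Equiv.Perm.coe_pow]
      exact hfk P
    rw [inv_pow, eq_inv_iff_mul_eq_one, ← pow_succ', h2]
  exact ⟨⟨F, hF ▸ hpow k, hinv⟩, fun P => rfl⟩

/-! ### Coordinate formulas and continuity of the two maps. -/

section
variable (hn : 1 ≤ n) (ha : Odd a) (h0 : lam ≠ 0) (h1 : lam ^ 4 ≠ 1)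

theorem tau₁_coord (P : Pts n a lam) :
    (tau₁ n a lam hn ha h0 h1 P = OnePoint.infty ↔ P = OnePoint.infty) ∧
    xCoord (tau₁ n a lam hn ha h0 h1 P) = -xCoord P ∧
    yCoord (tau₁ n a lam hn ha h0 h1 P) = rootOfUnity (2 ^ (n + 1)) * yCoord P := by
  induction P using OnePoint.rec with
  | infty =>
    exact ⟨Iff.rfl, (neg_zero (G := ℂ)).symm, (mul_zero (M₀ := ℂ) _).symm⟩
  | coe p =>
    exact ⟨iff_of_false (OnePoint.coe_ne_infty _) (OnePoint.coe_ne_infty _), rfl, rfl⟩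

/-- The formulas survive at the two interchanged points: both have coordinates `0` (the only affine
point with `x = 0` is `(0, 0)`), `0⁻¹ = 0`, and the numerator of the `y`-formula vanishes. Thus only
the condition at infinity needs separate bookkeeping. -/
theorem tau₂_coord {c : ℕ} (hc : c * 2 ^ (n - 1) = 2 * a + 2) (P : Pts n a lam) :
    (tau₂ n a c lam hn ha h0 h1 hc P = OnePoint.infty ↔ P ≠ OnePoint.infty ∧ xCoord P = 0) ∧
    xCoord (tau₂ n a c lam hn ha h0 h1 hc P) = (xCoord P)⁻¹ ∧
    yCoord (tau₂ n a c lam hn ha h0 h1 hc P) =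
      rootOfUnity (2 ^ (n + 1)) * yCoord P / xCoord P ^ c := by
  have hN : 2 ^ n ≠ 0 := by positivity
  have ha0 : a ≠ 0 := by rintro rfl; simp at ha
  induction P using OnePoint.rec with
  | infty =>
    refine ⟨iff_of_false (OnePoint.coe_ne_infty _) (fun h => h.1 rfl), ?_, ?_⟩
    · exact (inv_zero (G₀ := ℂ)).symm
    · change (0 : ℂ) = rootOfUnity (2 ^ (n + 1)) * 0 / _
      rw [mul_zero, zero_div]
  | coe p =>
    by_cases hp : p.1.1 = 0
    · have hτ : tau₂ n a c lam hn ha h0 h1 hc (p : Pts n a lam) = OnePoint.infty := dif_pos hp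
      have hy : p.1.2 = 0 := by
        have := mem_affineCurve.1 p.2
        rw [hp] at this
        simpa [rhs, ha0] using this
      refine ⟨iff_of_true hτ ⟨OnePoint.coe_ne_infty _, hp⟩, ?_, ?_⟩
      · rw [hτ, xCoord_coe, hp, inv_zero]; rfl
      · rw [hτ, yCoord_coe, hy, mul_zero, zero_div]; rfl
    · have hτ : tau₂ n a c lam hn ha h0 h1 hc (p : Pts n a lam) =
          OnePoint.some (X := affineCurve n a lam) ⟨(1 / p.1.1,
            rootOfUnity (2 ^ (n + 1)) * p.1.2 / p.1.1 ^ c), tau₂_mem hn ha h0 hc p hp⟩ :=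
        dif_neg hp
      refine ⟨iff_of_false ?_ (fun h => hp h.2), ?_, ?_⟩
      · rw [hτ]; exact OnePoint.coe_ne_infty _
      · rw [hτ, xCoord_coe, xCoord_coe]; exact one_div _
      · rw [hτ]; rfl

end

theorem continuous_of_coord_neg {f : Pts n a lam → Pts n a lam} {ζ : ℂ}
    (h : ∀ P, (f P = OnePoint.infty ↔ P = OnePoint.infty) ∧ xCoord (f P) = -xCoord P ∧
      yCoord (f P) = ζ * yCoord P) : Continuous f := by
  rw [continuous_iff_continuousAt]
  intro P
  by_cases hP : P = OnePoint.infty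
  · subst hP
    rw [ContinuousAt, (h _).1.2 rfl]
    refine tendsto_nhds_infty fun c => ?_
    filter_upwards [eventually_lt_norm_xCoord c] with t ht ht'
    rw [(h t).2.1, norm_neg]
    exact ht (mt (h t).1.2 ht')
  · refine tendsto_nhds_of_coord (mt (h P).1.1 hP) ?_ ?_ ?_
    · filter_upwards [isOpen_compl_singleton.mem_nhds hP] with t ht
      exact mt (h t).1.1 ht
    · simp only [h]
      exact (continuousAt_xCoord hP).neg
    · simp only [h]
      exact (continuousAt_yCoord hP).const_mul _

/-- Three cases: infinity goes to `(0, 0)`, the point with `x = 0` goes to infinity, and elsewhere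
the formulas are continuous. -/
theorem continuous_of_coord_inv (ha : Odd a) {f : Pts n a lam → Pts n a lam} {ζ : ℂ} {c : ℕ}
    (h : ∀ P, (f P = OnePoint.infty ↔ P ≠ OnePoint.infty ∧ xCoord P = 0) ∧
      xCoord (f P) = (xCoord P)⁻¹ ∧ yCoord (f P) = ζ * yCoord P / xCoord P ^ c) :
    Continuous f := by
  have ha0 : a ≠ 0 := by rintro rfl; simp at ha
  rw [continuous_iff_continuousAt]
  intro P
  by_cases hP : P = OnePoint.infty
  · subst hP
    have hne : f (OnePoint.infty : Pts n a lam) ≠ OnePoint.infty :=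
      fun h' => ((h _).1.1 h').1 rfl
    have hev : ∀ᶠ t : Pts n a lam in 𝓝 OnePoint.infty,
        f t ≠ OnePoint.infty := by
      filter_upwards [eventually_lt_norm_xCoord 0] with t ht ht'
      obtain ⟨h2, h3⟩ := (h t).1.1 ht'
      have := ht h2
      simp [h3] at this
    have hx0 : Tendsto (fun t : Pts n a lam => xCoord (f t))
        (𝓝 OnePoint.infty) (𝓝 0) := by
      rw [tendsto_zero_iff_norm_tendsto_zero, Metric.tendsto_nhds]
      intro ε hε
      filter_upwards [eventually_lt_norm_xCoord ε⁻¹] with t ht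
      rw [(h t).2.1, norm_inv, Real.dist_eq, sub_zero, abs_of_nonneg (by positivity)]
      by_cases hti : t = OnePoint.infty
      · subst hti
        change ‖(0 : ℂ)‖⁻¹ < ε
        simpa using hε
      · exact inv_lt_of_inv_lt₀ hε (ht hti)
    have hinf : xCoord (OnePoint.infty : Pts n a lam) = 0 ∧
        yCoord (OnePoint.infty : Pts n a lam) = 0 := ⟨rfl, rfl⟩
    -- No estimate of `y / x ^ c` at infinity is needed: the image lies on the curve and its `x`
    -- tends to `0`, so the equation forces its `y` to `0`.
    have hy0 := tendsto_yCoord_zero (by simp [rhs, ha0]) hev hx0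
    refine tendsto_nhds_of_coord hne hev ?_ ?_
    · rwa [(h _).2.1, hinf.1, inv_zero]
    · rwa [(h _).2.2, hinf.2, mul_zero, zero_div]
  · by_cases hx : xCoord P = 0
    · have hτ : f P = OnePoint.infty := (h P).1.2 ⟨hP, hx⟩
      rw [ContinuousAt, hτ]
      refine tendsto_nhds_infty fun b => ?_
      -- The factor `|b| + 1` is a positive bound exceeding `b`, so that inverting the inequality is
      -- legitimate even for negative `b`.
      have h2 : ∀ᶠ t in 𝓝 P, ‖xCoord t‖ * (|b| + 1) < 1 := by
        have : ContinuousAt (fun t : Pts n a lam => ‖xCoord t‖ * (|b| + 1)) P :=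
          (continuousAt_xCoord hP).norm.mul_const _
        apply this.eventually_lt continuousAt_const
        simp [hx]
      filter_upwards [h2, isOpen_compl_singleton.mem_nhds hP] with t ht hti hτt
      have hxt : 0 < ‖xCoord t‖ := norm_pos_iff.2 fun h3 => hτt ((h t).1.2 ⟨hti, h3⟩)
      rw [(h t).2.1, norm_inv]
      refine (le_abs_self b).trans_lt ((lt_add_one _).trans ?_)
      rwa [lt_inv_comm₀ (by positivity) hxt, ← one_div, lt_div_iff₀ (by positivity)]
    · have hev : ∀ᶠ t in 𝓝 P, xCoord t ≠ 0 := (continuousAt_xCoord hP).eventually_ne hx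
      refine tendsto_nhds_of_coord (fun h' => hx ((h P).1.1 h').2) ?_ ?_ ?_
      · filter_upwards [hev] with t ht h'
        exact ht ((h t).1.1 h').2
      · simp only [h]
        exact (continuousAt_xCoord hP).inv₀ hx
      · simp only [h]
        exact ((continuousAt_yCoord hP).const_mul _).div ((continuousAt_xCoord hP).pow c)
          (pow_ne_zero _ hx)

/-- A test point separating the maps: `y ≠ 0` distinguishes `y` from `-y`, and `x ^ 4 ≠ 1`
distinguishes `1/x` from `±x`. Only finitely many values of `x` are excluded. -/
theorem exists_xCoord_yCoord_ne_zero (n a : ℕ) (lam : ℂ) : ∃ P : Pts n a lam,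
    xCoord P ≠ 0 ∧ xCoord P ^ 4 ≠ 1 ∧ yCoord P ≠ 0 := by
  have hfin : ({0} ∪ {z : ℂ | z ^ 4 = 1} ∪ {z | z ^ 2 = lam ^ 2} ∪
      {z | z ^ 2 = (lam ^ 2)⁻¹}).Finite :=
    (((finite_singleton _).union (finite_roots (by norm_num) _)).union
      (finite_roots (by norm_num) _)).union (finite_roots (by norm_num) _)
  obtain ⟨x, hx⟩ := hfin.infinite_compl.nonempty
  simp only [mem_compl_iff, mem_union, mem_singleton_iff, mem_ofPred_eq, not_or] at hx
  obtain ⟨⟨⟨h0, h4⟩, hl⟩, hl'⟩ := hx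
  have h2 : x ^ 2 ≠ 1 := fun h => h4 (by rw [show x ^ 4 = (x ^ 2) ^ 2 by ring, h, one_pow])
  have hr : rhs a lam x ≠ 0 :=
    mul_ne_zero (mul_ne_zero (mul_ne_zero (pow_ne_zero _ h0) (pow_ne_zero _ (sub_ne_zero.2 h2)))
      (sub_ne_zero.2 hl)) (sub_ne_zero.2 hl')
  obtain ⟨y, hy⟩ := IsAlgClosed.exists_pow_nat_eq (rhs a lam x) (pow_pos two_pos n)
  refine ⟨((⟨(x, y), mem_affineCurve.2 hy⟩ : affineCurve n a lam) : Pts n a lam),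
    h0, h4, ?_⟩
  rintro (rfl : y = 0)
  rw [zero_pow (by positivity)] at hy
  exact hr hy.symm

/-! ### Relations between the two maps. -/

theorem coord_neg_iterate {f : Pts n a lam → Pts n a lam} {ζ : ℂ}
    (h : ∀ P, (f P = OnePoint.infty ↔ P = OnePoint.infty) ∧ xCoord (f P) = -xCoord P ∧
      yCoord (f P) = ζ * yCoord P) (k : ℕ) (P : Pts n a lam) :
    (f^[k] P = OnePoint.infty ↔ P = OnePoint.infty) ∧ xCoord (f^[k] P) = (-1) ^ k * xCoord P ∧
      yCoord (f^[k] P) = ζ ^ k * yCoord P := by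
  induction k with
  | zero => simp
  | succ k ih =>
    rw [Function.iterate_succ_apply', (h _).1, (h _).2.1, (h _).2.2, ih.2.1, ih.2.2]
    exact ⟨ih.1, by ring, by ring⟩

/-- Both squares are `(x, y) ↦ (x, ζ² y)`, since the factors `x ^ c` and `(1/x) ^ c` cancel. Where
`x = 0` this cancellation fails and `hy` makes both sides `0`. -/
theorem coord_inv_sq {f g : Pts n a lam → Pts n a lam} {ζ : ℂ} {c : ℕ}
    (hf : ∀ P, (f P = OnePoint.infty ↔ P = OnePoint.infty) ∧ xCoord (f P) = -xCoord P ∧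
      yCoord (f P) = ζ * yCoord P)
    (hg : ∀ P, (g P = OnePoint.infty ↔ P ≠ OnePoint.infty ∧ xCoord P = 0) ∧
      xCoord (g P) = (xCoord P)⁻¹ ∧ yCoord (g P) = ζ * yCoord P / xCoord P ^ c)
    (hy : ∀ P : Pts n a lam, xCoord P = 0 → yCoord P = 0) (P : Pts n a lam) :
    g (g P) = f (f P) := by
  have hinf : xCoord (OnePoint.infty : Pts n a lam) = 0 := rfl
  apply Pts.ext
  · rw [(hf _).1, (hf _).1, (hg _).1, (hg _).2.1, inv_eq_zero, ne_eq, (hg _).1]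
    by_cases hP : P = OnePoint.infty
    · subst hP; simp [hinf]
    · simp [hP]
  · rw [(hf _).2.1, (hf _).2.1, (hg _).2.1, (hg _).2.1, inv_inv, neg_neg]
  · rw [(hf _).2.2, (hf _).2.2, (hg _).2.2, (hg _).2.2, (hg _).2.1]
    by_cases hx : xCoord P = 0
    · rw [hy P hx]; simp
    · rw [inv_pow]; field_simp

/-- The left side is `(-1/x, ζ² y / (-x) ^ c)` and the right side is `((-1) ^ r / x, ζ ^ (r + 1) y /
x ^ c)`. Oddness of `r` matches the first coordinates and `hζ` the second. -/
theorem coord_neg_inv_comm {f g : Pts n a lam → Pts n a lam} {ζ : ℂ} {c r : ℕ}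
    (hf : ∀ P, (f P = OnePoint.infty ↔ P = OnePoint.infty) ∧ xCoord (f P) = -xCoord P ∧
      yCoord (f P) = ζ * yCoord P)
    (hg : ∀ P, (g P = OnePoint.infty ↔ P ≠ OnePoint.infty ∧ xCoord P = 0) ∧
      xCoord (g P) = (xCoord P)⁻¹ ∧ yCoord (g P) = ζ * yCoord P / xCoord P ^ c)
    (hr : Odd r) (hζ : ζ ^ r = (-1) ^ c * ζ) (P : Pts n a lam) :
    g (f P) = f^[r] (g P) := by
  have h := coord_neg_iterate hf r
  apply Pts.ext
  · rw [(h _).1, (hg _).1, (hg _).1, ne_eq, (hf _).1, (hf _).2.1, neg_eq_zero]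
  · rw [(h _).2.1, (hg _).2.1, (hg _).2.1, (hf _).2.1, hr.neg_one_pow, inv_neg, neg_one_mul]
  · rw [(h _).2.2, (hg _).2.2, (hg _).2.2, (hf _).2.1, (hf _).2.2, hζ, neg_pow (xCoord P),
      div_eq_mul_inv, div_eq_mul_inv, mul_inv, ← inv_pow (-1 : ℂ), inv_neg_one]
    ring

theorem yCoord_eq_zero (ha : Odd a) {P : Pts n a lam} (hx : xCoord P = 0) : yCoord P = 0 := by
  have ha0 : a ≠ 0 := by rintro rfl; simp at ha
  by_cases hP : P = OnePoint.infty
  · rw [hP]; rfl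
  · have := yCoord_pow hP
    rw [hx] at this
    simpa [rhs, ha0] using this

end
end TwoPowerCurve
end

/-! ### Arithmetic of the exponents and the theorem. -/

theorem two_pow_add_one_mul_self {R : Type*} [CommRing R] {n : ℕ} (hn : 1 ≤ n)
    (h : (2 : R) ^ (n + 1) = 0) : (2 ^ n + 1) * (2 ^ n + 1) = (1 : R) := by
  obtain ⟨j, rfl⟩ := Nat.exists_eq_add_of_le' hn
  linear_combination (2 ^ j + 1) * h

/-- The sum is `(2 ^ (n - 1) - 1) * (2 ^ n + 2) + 2 = 2 ^ (2n - 1)`, with quotient `2 ^ (n - 2)`.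
This is the exponent `k + r k + 2` for `k = 2 ^ (n - 1) - 1` and `r = 2 ^ n + 1`. -/
theorem two_pow_dvd_of_three_le {n : ℕ} (hn : 3 ≤ n) :
    2 ^ (n + 1) ∣ (2 ^ (n - 1) - 1) + (2 ^ n + 1) * (2 ^ (n - 1) - 1) + 2 := by
  obtain ⟨j, rfl⟩ := Nat.exists_eq_add_of_le' hn
  -- Here `w` is `2 ^ (n - 1) - 1`, introduced to eliminate the truncated subtraction.
  obtain ⟨w, hw⟩ := Nat.exists_eq_add_of_le' (Nat.one_le_two_pow (n := j + 2))
  rw [show j + 3 - 1 = j + 2 by omega, hw, Nat.add_sub_cancel]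
  refine ⟨2 * 2 ^ j, ?_⟩
  have h1 : (2 : ℕ) ^ (j + 3) = 2 * (w + 1) := by rw [← hw]; ring
  have h2 : (2 : ℕ) ^ (j + 3 + 1) * (2 * 2 ^ j) = 2 * (w + 1) * (w + 1) := by rw [← hw]; ring
  rw [h1, h2]
  ring

theorem mainTheorem5 (n a c : ℕ) (lam : ℂ) (hn : 1 ≤ n) (ha : Odd a) (h0 : lam ≠ 0)
    (h1 : lam ^ 4 ≠ 1) (hc : c * 2 ^ (n - 1) = 2 * a + 2) :
    ∃ τ₁ τ₂ : TwoPowerCurve.Aut (TwoPowerCurve.Surface n a lam hn ha h0 h1),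
      (∀ P, (τ₁ : Equiv.Perm (TwoPowerCurve.Surface n a lam hn ha h0 h1)) P =
        TwoPowerCurve.tau₁ n a lam hn ha h0 h1 P) ∧
      (∀ P, (τ₂ : Equiv.Perm (TwoPowerCurve.Surface n a lam hn ha h0 h1)) P =
        TwoPowerCurve.tau₂ n a c lam hn ha h0 h1 hc P) ∧
      orderOf τ₁ = 2 ^ (n + 1) ∧ orderOf τ₂ = 2 ^ (n + 1) ∧
      (Even c →
        τ₁ * τ₂ = τ₂ * τ₁ ∧
        Nonempty (Subgroup.closure {τ₁, τ₂} ≃*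
          Multiplicative (ZMod (2 ^ (n + 1))) × Multiplicative (ZMod 2))) ∧
      (Odd c →
        τ₂ * τ₁ = τ₁ ^ (2 ^ n + 1) * τ₂ ∧
        ∃ h : Multiplicative (ZMod 2) →* MulAut (Multiplicative (ZMod (2 ^ (n + 1)))),
          (∀ z : ZMod (2 ^ (n + 1)), h (Multiplicative.ofAdd 1) (Multiplicative.ofAdd z) =
            Multiplicative.ofAdd ((2 ^ n + 1) * z)) ∧
          Nonempty (Subgroup.closure {τ₁, τ₂} ≃*
            Multiplicative (ZMod (2 ^ (n + 1))) ⋊[h] Multiplicative (ZMod 2))) := by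
  set ζ := TwoPowerCurve.rootOfUnity (2 ^ (n + 1)) with hζ
  have hζN : ζ ^ 2 ^ n = -1 := TwoPowerCurve.rootOfUnity_pow n
  have hζ1 : ζ ^ 2 ^ (n + 1) = 1 := by rw [pow_succ, pow_mul, hζN, neg_one_sq]
  have hN2 : 2 ^ n = 2 * 2 ^ (n - 1) := by rw [← pow_succ', Nat.sub_add_cancel hn]
  have hNe : Even (2 ^ n) := by rw [hN2]; exact even_two_mul _
  let f : TwoPowerCurve.Pts n a lam → TwoPowerCurve.Pts n a lam :=
    TwoPowerCurve.tau₁ n a lam hn ha h0 h1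
  let g : TwoPowerCurve.Pts n a lam → TwoPowerCurve.Pts n a lam :=
    TwoPowerCurve.tau₂ n a c lam hn ha h0 h1 hc
  have hf : ∀ P, (f P = OnePoint.infty ↔ P = OnePoint.infty) ∧
      TwoPowerCurve.xCoord (f P) = -TwoPowerCurve.xCoord P ∧
      TwoPowerCurve.yCoord (f P) = ζ * TwoPowerCurve.yCoord P :=
    TwoPowerCurve.tau₁_coord hn ha h0 h1
  have hg : ∀ P, (g P = OnePoint.infty ↔ P ≠ OnePoint.infty ∧ TwoPowerCurve.xCoord P = 0) ∧
      TwoPowerCurve.xCoord (g P) = (TwoPowerCurve.xCoord P)⁻¹ ∧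
      TwoPowerCurve.yCoord (g P) = ζ * TwoPowerCurve.yCoord P / TwoPowerCurve.xCoord P ^ c :=
    TwoPowerCurve.tau₂_coord hn ha h0 h1 hc
  have hfk := TwoPowerCurve.coord_neg_iterate hf
  have hgg : ∀ P, g (g P) = f (f P) :=
    TwoPowerCurve.coord_inv_sq hf hg (fun P => TwoPowerCurve.yCoord_eq_zero ha)
  have hfone : ∀ P, f^[2 ^ (n + 1)] P = P := fun P => TwoPowerCurve.Pts.ext (hfk _ P).1
    (by rw [(hfk _ P).2.1, pow_succ, pow_mul, hNe.neg_one_pow, one_pow, one_mul])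
    (by rw [(hfk _ P).2.2, hζ1, one_mul])
  have hgone : ∀ P, g^[2 ^ (n + 1)] P = P := by
    have : g^[2] = f^[2] := funext hgg
    intro P
    rw [pow_succ', Function.iterate_mul, this, ← Function.iterate_mul, ← pow_succ']
    exact hfone P
  obtain ⟨τ₁, hτ₁⟩ := TwoPowerCurve.exists_aut_of_coord (hn := hn) (ha := ha) (h0 := h0) (h1 := h1)
    (TwoPowerCurve.continuous_of_coord_neg hf) (by positivity) hfone
    (U := fun p => -p.1) (V := fun p => ζ * p.2)
    (fun P _ _ => ⟨(hf P).2.1, by fun_prop⟩) (fun P _ _ => ⟨(hf P).2.2, by fun_prop⟩)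
  have hx0 : ∀ P, P ≠ OnePoint.infty → g P ≠ OnePoint.infty → TwoPowerCurve.xCoord P ≠ 0 :=
    fun P hP hgP hx => hgP ((hg P).1.2 ⟨hP, hx⟩)
  have hV : ∀ p : ℂ × ℂ, p.1 ≠ 0 → DifferentiableAt ℂ (fun p : ℂ × ℂ => ζ * p.2 / p.1 ^ c) p := by
    intro p hp
    simp only [div_eq_mul_inv]
    exact DifferentiableAt.fun_mul (by fun_prop)
      (DifferentiableAt.fun_inv (by fun_prop) (pow_ne_zero c hp))
  obtain ⟨τ₂, hτ₂⟩ := TwoPowerCurve.exists_aut_of_coord (hn := hn) (ha := ha) (h0 := h0) (h1 := h1)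
    (TwoPowerCurve.continuous_of_coord_inv ha hg) (by positivity) hgone
    (U := fun p => p.1⁻¹) (V := fun p => ζ * p.2 / p.1 ^ c)
    (fun P hP hgP => ⟨(hg P).2.1, differentiableAt_fst.inv (hx0 P hP hgP)⟩)
    (fun P hP hgP => ⟨(hg P).2.2, hV _ (hx0 P hP hgP)⟩)
  have hext : ∀ {σ σ' : TwoPowerCurve.Aut (TwoPowerCurve.Surface n a lam hn ha h0 h1)},
      (∀ P, (σ : Equiv.Perm (TwoPowerCurve.Surface n a lam hn ha h0 h1)) P =
        (σ' : Equiv.Perm (TwoPowerCurve.Surface n a lam hn ha h0 h1)) P) → σ = σ' :=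
    fun h => Subtype.ext (Equiv.ext h)
  have hpow : ∀ (k : ℕ) (P : TwoPowerCurve.Pts n a lam),
      ((τ₁ ^ k : TwoPowerCurve.Aut (TwoPowerCurve.Surface n a lam hn ha h0 h1)) :
        Equiv.Perm (TwoPowerCurve.Surface n a lam hn ha h0 h1)) P = f^[k] P := by
    intro k
    induction k with
    | zero => exact fun P => rfl
    | succ k ih =>
      intro P
      rw [pow_succ]
      exact (congrArg _ (hτ₁ P)).trans (ih (f P))
  obtain ⟨Q, hQ0, hQ4, hQy⟩ := TwoPowerCurve.exists_xCoord_yCoord_ne_zero n a lam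
  have hs1 : τ₁ ^ 2 ^ (n + 1) = 1 := hext fun P => (hpow _ P).trans (hfone P)
  -- This power multiplies `y` by `ζ ^ 2 ^ n = -1`, which moves the point `Q` with `y ≠ 0`.
  have hsN : τ₁ ^ 2 ^ n ≠ 1 := by
    intro h
    have h2 : f^[2 ^ n] Q = Q := by rw [← hpow, h]; rfl
    have h3 := (hfk (2 ^ n) Q).2.2
    rw [h2, hζN, neg_one_mul] at h3
    exact hQy (self_eq_neg.1 h3)
  have hsord : orderOf τ₁ = 2 ^ (n + 1) := orderOf_eq_prime_pow hsN hs1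
  have hsq : τ₂ * τ₂ = τ₁ * τ₁ := hext fun P =>
    (congrArg _ (hτ₂ P)).trans ((hτ₂ _).trans ((hgg P).trans
      ((congrArg _ (hτ₁ P)).trans (hτ₁ _)).symm))
  have hsq2 : ∀ k, τ₂ ^ (2 * k) = τ₁ ^ (2 * k) := by
    intro k
    rw [pow_mul, pow_mul, sq, sq, hsq]
  -- Even powers of `τ₂` and `τ₁` agree, and `2 ^ n` is even because `n ≥ 1`.
  have htord : orderOf τ₂ = 2 ^ (n + 1) := by
    refine orderOf_eq_prime_pow ?_ ?_
    · rw [hN2, hsq2, ← hN2]; exact hsN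
    · rw [pow_succ', hsq2, ← pow_succ']; exact hs1
  -- If `τ₂ = τ₁ ^ k`, then `1/x = (-1) ^ k x` at `Q`, which gives `x ^ 4 = 1` there.
  have htn : τ₂ ∉ Subgroup.zpowers τ₁ := by
    intro h
    have hfin : IsOfFinOrder τ₁ := orderOf_pos_iff.1 (by rw [hsord]; positivity)
    obtain ⟨k, hk⟩ := hfin.mem_powers_iff_mem_zpowers.2 h
    have h2 : g Q = f^[k] Q := by
      rw [← hpow, ← hτ₂]
      exact congrArg (fun σ : TwoPowerCurve.Aut (TwoPowerCurve.Surface n a lam hn ha h0 h1) =>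
        (σ : Equiv.Perm (TwoPowerCurve.Surface n a lam hn ha h0 h1)) Q) hk.symm
    have h3 := congrArg TwoPowerCurve.xCoord h2
    rw [(hg Q).2.1, (hfk k Q).2.1] at h3
    have h4 : (1 : ℂ) = (-1) ^ k * TwoPowerCurve.xCoord Q ^ 2 := by
      rw [sq, ← mul_assoc, ← h3, inv_mul_cancel₀ hQ0]
    refine hQ4 ?_
    calc TwoPowerCurve.xCoord Q ^ 4
        = ((-1) ^ k * (-1) ^ k) * (TwoPowerCurve.xCoord Q ^ 4) := by
          rw [← mul_pow, neg_one_mul, neg_neg, one_pow, one_mul]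
      _ = ((-1) ^ k * TwoPowerCurve.xCoord Q ^ 2) ^ 2 := by ring
      _ = 1 := by rw [← h4, one_pow]
  have hcomm : ∀ r : ℕ, Odd r → ζ ^ r = (-1) ^ c * ζ → τ₂ * τ₁ = τ₁ ^ r * τ₂ := fun r hr hr' =>
    hext fun P => (congrArg _ (hτ₁ P)).trans ((hτ₂ _).trans
      ((TwoPowerCurve.coord_neg_inv_comm hf hg hr hr' P).trans
        ((congrArg _ (hτ₂ P)).trans (hpow r _)).symm))
  refine ⟨τ₁, τ₂, hτ₁, hτ₂, hsord, htord, fun hce => ?_, fun hco => ?_⟩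
  · have hst := hcomm 1 odd_one (by rw [hce.neg_one_pow, pow_one, one_mul])
    refine ⟨by rw [hst, pow_one], ?_⟩
    have hpos : 0 < 2 ^ (n + 1) := by positivity
    -- The exponent `k` represents `-1`, so the involution is `τ₁⁻¹ τ₂`, and `k + k + 2 = 2 * 2 ^ (n
    -- + 1)`. With `r = 1` the action is trivial and the semidirect product is direct.
    obtain ⟨e⟩ := closure_pair_mulEquiv_semidirectProduct_of_sq (k := 2 ^ (n + 1) - 1) hsord hsq hst
      htn ⟨2, by omega⟩ 1 (fun z => by simp)
    exact ⟨e.trans SemidirectProduct.mulEquivProd⟩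
  · have hst := hcomm (2 ^ n + 1) hNe.add_one
      (by rw [hco.neg_one_pow, pow_succ, hζN])
    obtain ⟨h, hh⟩ := exists_zmodTwo_mulAut (2 ^ (n + 1)) (2 ^ n + 1) (by
      refine two_pow_add_one_mul_self hn ?_
      exact_mod_cast ZMod.natCast_self (2 ^ (n + 1)))
    refine ⟨hst, h, hh, ?_⟩
    refine closure_pair_mulEquiv_semidirectProduct_of_sq (k := 2 ^ (n - 1) - 1) hsord hsq hst htn ?_ h
      (by push_cast; exact hh)
    obtain ⟨b, hb⟩ := ha
    -- Since `a = 2b + 1`, the right side of `hc` is `4 (b + 1)`; with `c` odd, `4` must divide `2 ^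
    -- (n - 1)`.
    have hn3 : 3 ≤ n := by
      by_contra! hlt
      have hco' := Nat.odd_iff.1 hco
      interval_cases n <;> omega
    exact two_pow_dvd_of_three_le hn3
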